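/- Let $M$ be a smooth (Hausdorff) manifold of dimension $m$ with a smooth affine connection $\nabla$. For $\xi\in M$ and $v\in T_\xi M$ let $\gamma_v$ be the geodesic ($\nabla_{\dot\gamma}\dot\gamma=0$) with $\gamma_v(0)=\xi$, $\dot\gamma_v(0)=v$, and let $\exp_\xi(v)=\gamma_v(1)$ whenever $\gamma_v$ lives beyond time $1$. For each $\xi$ let $W_\xi\subset T_\xi M$ be an open neighbourhood of $0$ in the domain of $\exp_\xi$ that $\exp_\xi$ maps diffeomorphically onto an open set $U_\xi\subset M$, and let $\imath_\xi:T_\xi M\to\mathbb R^m$ be a linear isomorphism. Define the normal coordinates $\vartheta_\xi=\imath_\xi\circ(\exp_\xi|_{W_\xi})^{-1}:U_\xi\to\mathbb R^m$, $\ \vartheta_\xi^{-1}=\exp_\xi\circ\imath_\xi^{-1}$, and $$\xi\boxplus u=\vartheta_\xi^{-1}(u),\qquad \zeta\boxminus\xi=\vartheta_\xi(\zeta).$$ Consider the system $\xi_{k+1}=F(\xi_k,u_{k+1})\boxplus\kappa_{k+1}$ with state $\xi_k\in M$, input $u_{k+1}$ and noise $\kappa_{k+1}\in\mathbb R^m$.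 Let $\hat\xi_{k|k}\in M$ be an estimate, let $F_{u_{k+1}}=F(\cdot,u_{k+1}):M\to M$ be of class $C^2$ around $\hat\xi_{k|k}$, put $\hat\xi_{k+1|k}=F(\hat\xi_{k|k},u_{k+1})$, and assume that $\imath_\xi$ depends continuously differentiably on $\xi$ near $\hat\xi_{k+1|k}$ (that is, for every $w\in\mathbb R^m$ the vector field $\xi\mapsto\imath_\xi^{-1}w$ is $C^1$ there). Let $$\epsilon_{k|k}=\xi_k\boxminus\hat\xi_{k|k},\qquad \epsilon_{k+1|k}=\xi_{k+1}\boxminus\hat\xi_{k+1|k},$$ $$A_{k+1}=D\vartheta_{\hat\xi_{k+1|k}}(\hat\xi_{k+1|k})\cdot DF_{u_{k+1}}(\hat\xi_{k|k})\cdot D\vartheta^{-1}_{\hat\xi_{k|k}}(0).$$ Then $$\epsilon_{k+1|k}=A_{k+1}\,\epsilon_{k|k}+\kappa_{k+1}+O\big(|\epsilon_{k|k},\kappa_{k+1}|^2\big)\qquad\text{as }(\epsilon_{k|k},\kappa_{k+1})\to 0.$$ Precisely, there are $C,\delta>0$ such that for all $\xi_k\in U_{\hat\xi_{k|k}}$ and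 all noise values $\kappa_{k+1}\in\mathbb R^m$ with $|\epsilon_{k|k}|<\delta$ and $|\kappa_{k+1}|<\delta$, the point $\xi_{k+1}$ is defined, $\xi_{k+1}\in U_{\hat\xi_{k+1|k}}$, and $$\big|\epsilon_{k+1|k}-A_{k+1}\epsilon_{k|k}-\kappa_{k+1}\big|\le C\big(|\epsilon_{k|k}|^2+|\kappa_{k+1}|^2\big).$$ -/

import Mathlib

open Set Function Topology Bundle
open scoped Manifold ContDiff

noncomputable section

namespace ManifoldEKF

/-- `ℝᵐ` with its Euclidean norm. -/
abbrev Vec (m : ℕ) : Type := EuclideanSpace ℝ (Fin m)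

section Geodesics

variable {m : ℕ} {M : Type*} [TopologicalSpace M] [ChartedSpace (Vec m) M]
  [IsManifold (𝓡 m) ∞ M]

/-- The velocity `γ'(t) ∈ T_{γ(t)} M` of a curve. -/
def velocity (γ : ℝ → M) (t : ℝ) : TangentSpace (𝓡 m) (γ t) :=
  mfderiv 𝓘(ℝ, ℝ) (𝓡 m) γ t (1 : ℝ)

/-- The covariant derivative `∇_{γ'} V` at time `t` of a vector field `V` along a curve `γ`.
With respect to the coordinate frame `E₁, …, Eₘ` of the chart at `γ(t)`, in which
`V = ∑ i, vᵢ Eᵢ` along `γ`, it is `∑ i, vᵢ'(t) Eᵢ + ∑ i, vᵢ(t) ∇_{γ'(t)} Eᵢ`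
(`∇ X p v` is Mathlib's argument order for `∇_v X` at `p`). -/
def covariantDerivAlong (nabla : CovariantDerivative (𝓡 m) (Vec m) (TangentSpace (𝓡 m) (M := M)))
    (γ : ℝ → M) (V : ∀ t, TangentSpace (𝓡 m) (γ t)) (t : ℝ) : TangentSpace (𝓡 m) (γ t) :=
  let e := trivializationAt (Vec m) (TangentSpace (𝓡 m) (M := M)) (γ t)
  let v : ℝ → Vec m := fun s => (e ⟨γ s, V s⟩).2
  e.symm (γ t) (deriv v t) + nabla (fun p => e.symm p (v t)) (γ t) (velocity γ t)

/-- `γ` is a geodesic on the open set of times `J`: it is twice continuously differentiable there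
and `∇_{γ'} γ' = 0`. -/
def IsGeodesicOn (nabla : CovariantDerivative (𝓡 m) (Vec m) (TangentSpace (𝓡 m) (M := M)))
    (γ : ℝ → M) (J : Set ℝ) : Prop :=
  ContMDiffOn 𝓘(ℝ, ℝ) (𝓡 m) 2 γ J ∧
    ∀ t ∈ J, covariantDerivAlong nabla γ (velocity γ) t = 0

/-- `γ` is a geodesic with `γ(0) = ξ`, `γ'(0) = v`, defined on an open interval that contains
`0` and `1`. -/
def IsExpGeodesic (nabla : CovariantDerivative (𝓡 m) (Vec m) (TangentSpace (𝓡 m) (M := M)))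
    (ξ : M) (v : TangentSpace (𝓡 m) ξ) (γ : ℝ → M) : Prop :=
  (∃ a b : ℝ, a < 0 ∧ 1 < b ∧ IsGeodesicOn nabla γ (Ioo a b)) ∧
    (⟨γ 0, velocity γ 0⟩ : TangentBundle (𝓡 m) M) = ⟨ξ, v⟩

/-- The domain of `exp_ξ`: the initial velocities whose geodesic lives up to time `1`. -/
def expDomain (nabla : CovariantDerivative (𝓡 m) (Vec m) (TangentSpace (𝓡 m) (M := M)))
    (ξ : M) : Set (TangentSpace (𝓡 m) ξ) :=
  {v | ∃ γ : ℝ → M, IsExpGeodesic nabla ξ v γ}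

open scoped Classical in
/-- The exponential map `exp_ξ(v) = γ_v(1)` (with the value `ξ` outside its domain). -/
def expMap (nabla : CovariantDerivative (𝓡 m) (Vec m) (TangentSpace (𝓡 m) (M := M)))
    (ξ : M) (v : TangentSpace (𝓡 m) ξ) : M :=
  if h : ∃ γ : ℝ → M, IsExpGeodesic nabla ξ v γ then h.choose 1 else ξ

/-- `W ⊆ T_ξ M` is an open neighbourhood of `0`, contained in the domain of `exp_ξ`, that
`exp_ξ` maps diffeomorphically onto an open set. (Smoothness on `T_ξ M` is read in the vector
space `ℝᵐ` which Mathlib uses as the tangent space.) -/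
structure IsNormalDomain
    (nabla : CovariantDerivative (𝓡 m) (Vec m) (TangentSpace (𝓡 m) (M := M)))
    (ξ : M) (W : Set (TangentSpace (𝓡 m) ξ)) : Prop where
  isOpen : IsOpen W
  zero_mem : 0 ∈ W
  subset_expDomain : W ⊆ expDomain nabla ξ
  injOn : InjOn (expMap nabla ξ) W
  isOpen_image : IsOpen (expMap nabla ξ '' W)
  contMDiffOn : ContMDiffOn 𝓘(ℝ, Vec m) (𝓡 m) ∞ (fun v : Vec m => expMap nabla ξ v) W
  contMDiffOn_inv : ContMDiffOn (𝓡 m) 𝓘(ℝ, Vec m) ∞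
    (fun ζ : M => (invFunOn (expMap nabla ξ) W ζ : Vec m)) (expMap nabla ξ '' W)

/-- The normal coordinates `ϑ_ξ = ı_ξ ∘ exp_ξ⁻¹` on `U_ξ = exp_ξ(W_ξ)`, where `exp_ξ⁻¹` is the
inverse of `exp_ξ` restricted to `W_ξ`. Only its values on `U_ξ` are meaningful. -/
def normalCoord (nabla : CovariantDerivative (𝓡 m) (Vec m) (TangentSpace (𝓡 m) (M := M)))
    (W : ∀ ξ : M, Set (TangentSpace (𝓡 m) ξ)) (ι : ∀ ξ : M, TangentSpace (𝓡 m) ξ ≃L[ℝ] Vec m)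
    (ξ ζ : M) : Vec m :=
  ι ξ (invFunOn (expMap nabla ξ) (W ξ) ζ)

/-- The inverse normal coordinates `ϑ_ξ⁻¹ = exp_ξ ∘ ı_ξ⁻¹`. -/
def normalCoordInv (nabla : CovariantDerivative (𝓡 m) (Vec m) (TangentSpace (𝓡 m) (M := M)))
    (ι : ∀ ξ : M, TangentSpace (𝓡 m) ξ ≃L[ℝ] Vec m) (ξ : M) (u : Vec m) : M :=
  expMap nabla ξ ((ι ξ).symm u)

/-- `ξ ⊞ u = ϑ_ξ⁻¹(u)`. -/
def boxplus (nabla : CovariantDerivative (𝓡 m) (Vec m) (TangentSpace (𝓡 m) (M := M)))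
    (ι : ∀ ξ : M, TangentSpace (𝓡 m) ξ ≃L[ℝ] Vec m) (ξ : M) (u : Vec m) : M :=
  normalCoordInv nabla ι ξ u

/-- `ζ ⊟ ξ = ϑ_ξ(ζ)`. -/
def boxminus (nabla : CovariantDerivative (𝓡 m) (Vec m) (TangentSpace (𝓡 m) (M := M)))
    (W : ∀ ξ : M, Set (TangentSpace (𝓡 m) ξ)) (ι : ∀ ξ : M, TangentSpace (𝓡 m) ξ ≃L[ℝ] Vec m)
    (ζ ξ : M) : Vec m :=
  normalCoord nabla W ι ξ ζ

/-- The matrix `A = Dϑ_{f(x)}(f(x)) · Df(x) · Dϑ_x⁻¹(0)` of a state map `f : M → M` at the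
estimate `x`. (`Dϑ_x⁻¹(0)` has values in the tangent space at `ϑ_x⁻¹(0) = x`.) -/
def stateMatrix (nabla : CovariantDerivative (𝓡 m) (Vec m) (TangentSpace (𝓡 m) (M := M)))
    (W : ∀ ξ : M, Set (TangentSpace (𝓡 m) ξ)) (ι : ∀ ξ : M, TangentSpace (𝓡 m) ξ ≃L[ℝ] Vec m)
    (f : M → M) (x : M) : Vec m →L[ℝ] Vec m :=
  let dϑ : TangentSpace (𝓡 m) (f x) →L[ℝ] Vec m :=
    mfderiv (𝓡 m) 𝓘(ℝ, Vec m) (normalCoord nabla W ι (f x)) (f x)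
  let df : TangentSpace (𝓡 m) x →L[ℝ] TangentSpace (𝓡 m) (f x) :=
    mfderiv (𝓡 m) (𝓡 m) f x
  let dϑinv : Vec m →L[ℝ] TangentSpace (𝓡 m) x :=
    mfderiv 𝓘(ℝ, Vec m) (𝓡 m) (normalCoordInv nabla ι x) (0 : Vec m)
  dϑ.comp (df.comp dϑinv)

end Geodesics

end ManifoldEKF

end

/-!
Everything is read in the preferred chart at `y = F(ξ̂, u)`. There a geodesic is a solution of
`x'' = -Γ(x)(x', x')`, where the Christoffel map `Γ` is smooth on the target of the chart
(`covariantDerivAlong_velocity_eq_zero_iff`, `contDiffAt_chartChristoffel`). The acceleration is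
quadratic in the velocity, so Grönwall's inequality gives

  `exp_p(v) = p + v + O(‖v‖²)`, uniformly for `p` near `y`  (`expMap_expansion`).

This uniform estimate replaces the joint smoothness of `(p, v) ↦ exp_p(v)`, and with it the smooth
dependence of solutions on their initial values. Since `expMap` is defined by an arbitrary choice
of a geodesic, the estimate also rests on the uniqueness of geodesics in a Hausdorff manifold
(`IsChartGeodesicOn.eq_of_isGeodesicOn`).

Let `Θ` be the normal coordinates at `y`, `g` the map `ε ↦ F(ϑ_ξ̂⁻¹(ε), u)` and `Λ(p) = ı_p⁻¹`, all
read in the chart. With `x = g(ε)` and `a` the chart value of `F(ξ, u) ⊞ κ`,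

  `Θ(a) - Θ(g(0)) = [Θ(a) - Θ(x)] + [Θ(x) - Θ(g(0))]`.

The second bracket is `A ε + O(‖ε‖²)` by Taylor's formula for `Θ ∘ g`. The first is
`DΘ(g(0)) Λ(g(0)) κ + O(‖ε‖² + ‖κ‖²)`: `a - x` is `Λ(x) κ + O(‖κ‖²)` by the estimate above, `DΘ` may
be frozen at `g(0)` because `Θ` is `C²`, and `Λ` because it is `C¹` (`exists_second_order_bound`).
Finally `DΘ(g(0)) Λ(g(0)) = id`, because the same estimate at `p = y` says that `exp_y` has the
identity as its differential at `0` (`fderiv_normalCoord_chartFrame`).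
-/

noncomputable section

namespace ManifoldEKF

/-! ### Chain rules -/

section ChainRule

variable {m : ℕ} {M : Type*} [TopologicalSpace M] [ChartedSpace (Vec m) M]

/-- The chain rule for a vector-valued function along a curve. -/
lemma hasDerivAt_comp_curve {G : Type*} [NormedAddCommGroup G] [NormedSpace ℝ G] {g : M → G}
    {γ : ℝ → M} {t : ℝ} (hg : MDifferentiableAt (𝓡 m) 𝓘(ℝ, G) g (γ t))
    (hγ : MDifferentiableAt 𝓘(ℝ, ℝ) (𝓡 m) γ t) :
    HasDerivAt (fun s => g (γ s)) (mvfderiv (𝓡 m) g (γ t) (velocity γ t)) t := by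
  let D : ℝ →L[ℝ] G := (mfderiv (𝓡 m) 𝓘(ℝ, G) g (γ t)).comp (mfderiv 𝓘(ℝ, ℝ) (𝓡 m) γ t)
  have h : HasFDerivAt (fun s => g (γ s)) D t :=
    hasMFDerivAt_iff_hasFDerivAt.1 (hg.hasMFDerivAt.comp t hγ.hasMFDerivAt)
  exact h.hasDerivAt

/-- The chain rule for a map between manifolds read in coordinates on both sides. -/
lemma hasFDerivAt_comp_comp {h : Vec m → M} {f : M → M} {θ : M → Vec m} {x : M}
    {A : Vec m →L[ℝ] Vec m} (hx : h 0 = x)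
    (hh : MDifferentiableAt 𝓘(ℝ, Vec m) (𝓡 m) h 0) (hf : MDifferentiableAt (𝓡 m) (𝓡 m) f x)
    (hθ : MDifferentiableAt (𝓡 m) 𝓘(ℝ, Vec m) θ (f x))
    (hA : ∀ e, A e = mfderiv (𝓡 m) 𝓘(ℝ, Vec m) θ (f x) (mfderiv (𝓡 m) (𝓡 m) f x
      (mfderiv 𝓘(ℝ, Vec m) (𝓡 m) h 0 e : Vec m))) :
    HasFDerivAt (fun e => θ (f (h e))) A 0 := by
  subst hx
  have hcomp := hθ.hasMFDerivAt.comp (0 : Vec m) (hf.hasMFDerivAt.comp (0 : Vec m)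
    hh.hasMFDerivAt)
  let D : Vec m →L[ℝ] Vec m := (mfderiv (𝓡 m) 𝓘(ℝ, Vec m) θ (f (h 0))).comp
    ((mfderiv (𝓡 m) (𝓡 m) f (h 0)).comp (mfderiv 𝓘(ℝ, Vec m) (𝓡 m) h 0))
  have hAD : A = D := ContinuousLinearMap.ext hA
  rw [hAD]
  exact hasMFDerivAt_iff_hasFDerivAt.1 hcomp

end ChainRule

/-! ### Coordinate frames and Christoffel symbols -/

section Connection

variable {m : ℕ} {M : Type*} [TopologicalSpace M] [ChartedSpace (Vec m) M]
  [IsManifold (𝓡 m) ∞ M]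

/-- The trivialization of `TM` over the domain of the chart at `y`, i.e. the coordinate frame. -/
abbrev tangentTriv (y : M) :
    Trivialization (Vec m) (TotalSpace.proj : TangentBundle (𝓡 m) M → M) :=
  trivializationAt (Vec m) (TangentSpace (𝓡 m) (M := M)) y

/-- The vector field with coefficients `a` in the coordinate frame of the chart at `y` (and the
value `0` outside the domain of the chart). -/
def frameField (y : M) (a : M → Vec m) (p : M) : TangentSpace (𝓡 m) p :=
  (tangentTriv y).symmL ℝ p (a p)

lemma frameField_apply {y p : M} (hp : p ∈ (chartAt (Vec m) y).source) (a : M → Vec m) :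
    frameField y a p = (tangentTriv y).symm p (a p) :=
  Trivialization.symmL_apply (R := ℝ) (tangentTriv (m := m) y) hp _

lemma tangentTriv_frameField {y p : M} (hp : p ∈ (chartAt (Vec m) y).source) (a : M → Vec m) :
    (tangentTriv y ⟨p, frameField y a p⟩).2 = a p := by
  have hb : p ∈ (tangentTriv y).baseSet := hp
  rw [frameField_apply hp, (tangentTriv y).apply_mk_symm hb]

lemma mdifferentiableAt_frameField {y x : M} (hx : x ∈ (chartAt (Vec m) y).source)
    {a : M → Vec m} (ha : MDifferentiableAt (𝓡 m) 𝓘(ℝ, Vec m) a x) :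
    MDifferentiableAt (𝓡 m) (𝓡 m).tangent
      (fun p => (⟨p, frameField y a p⟩ : TangentBundle (𝓡 m) M)) x := by
  have hb : x ∈ (tangentTriv y).baseSet := hx
  refine ((tangentTriv y).mdifferentiableAt_section_iff (𝓡 m) (frameField y a) hb).2 ?_
  refine ha.congr_of_eventuallyEq ?_
  filter_upwards [(tangentTriv y).open_baseSet.mem_nhds hb] with p hp
  exact tangentTriv_frameField hp a

lemma contMDiffAt_frameField {y x : M} (hx : x ∈ (chartAt (Vec m) y).source)
    {a : M → Vec m} (ha : ContMDiffAt (𝓡 m) 𝓘(ℝ, Vec m) ∞ a x) :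
    ContMDiffAt (𝓡 m) (𝓡 m).tangent ∞
      (fun p => (⟨p, frameField y a p⟩ : TangentBundle (𝓡 m) M)) x := by
  have hb : x ∈ (tangentTriv y).baseSet := hx
  refine ((tangentTriv y).contMDiffAt_section_iff (IB := 𝓡 m) (s := frameField y a) hb).2 ?_
  refine ha.congr_of_eventuallyEq ?_
  filter_upwards [(tangentTriv y).open_baseSet.mem_nhds hb] with p hp
  exact tangentTriv_frameField hp a

variable (nabla : CovariantDerivative (𝓡 m) (Vec m) (TangentSpace (𝓡 m) (M := M)))

/-- The Leibniz rule for finite linear combinations with variable coefficients. -/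
lemma nabla_sum_smul {ι : Type*} (S : Finset ι) (g : ι → M → ℝ)
    (σ : ι → ∀ p : M, TangentSpace (𝓡 m) p) {x : M}
    (hg : ∀ i, MDifferentiableAt (𝓡 m) 𝓘(ℝ, ℝ) (g i) x)
    (hσ : ∀ i, MDifferentiableAt (𝓡 m) (𝓡 m).tangent
      (fun p => (⟨p, σ i p⟩ : TangentBundle (𝓡 m) M)) x) (u : TangentSpace (𝓡 m) x) :
    nabla (fun p => ∑ i ∈ S, g i p • σ i p) x u
      = ∑ i ∈ S, (g i x • nabla (σ i) x u + mvfderiv (𝓡 m) (g i) x u • σ i x) := by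
  classical
  induction S using Finset.induction_on with
  | empty =>
    have := congrFun (CovariantDerivative.zero nabla) x
    simp only [Finset.sum_empty]
    exact congrArg (fun L => L u) this
  | insert j S hj ih =>
    have h1 : (fun p => ∑ i ∈ insert j S, g i p • σ i p)
        = (g j • σ j) + fun p => ∑ i ∈ S, g i p • σ i p := by
      funext p
      simp [Finset.sum_insert hj]
    have hs : MDifferentiableAt (𝓡 m) (𝓡 m).tangent
        (fun p => (⟨p, ∑ i ∈ S, g i p • σ i p⟩ : TangentBundle (𝓡 m) M)) x :=
      MDifferentiableAt.sum_section (t := fun i p => g i p • σ i p)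
        (fun i _ => (hg i).smul_section (hσ i))
    rw [h1, Finset.sum_insert hj, ← ih,
      nabla.isCovariantDerivativeOnUniv.add ((hg j).smul_section (hσ j)) hs,
      nabla.isCovariantDerivativeOnUniv.leibniz (hσ j) (hg j)]
    rfl

lemma frameField_eq_sum (y : M) (a : M → Vec m) :
    frameField y a
      = fun p => ∑ i, a p i • frameField y (fun _ => EuclideanSpace.single i (1 : ℝ)) p := by
  funext p
  simp only [frameField, ← map_smul, ← map_sum]
  congr 1
  simpa using ((EuclideanSpace.basisFun (Fin m) ℝ).sum_repr (a p)).symm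

/-- The Leibniz rule in a coordinate frame: the coefficients are differentiated, and the rest of
the covariant derivative only involves their values at the point. -/
lemma nabla_frameField {y x : M} (hx : x ∈ (chartAt (Vec m) y).source) {a : M → Vec m}
    (ha : MDifferentiableAt (𝓡 m) 𝓘(ℝ, Vec m) a x) (u : TangentSpace (𝓡 m) x) :
    nabla (frameField y a) x u
      = (tangentTriv y).symmL ℝ x (mvfderiv (𝓡 m) a x u) + nabla (frameField y fun _ => a x) x u := by
  have hg : ∀ i, HasMFDerivAt (𝓡 m) 𝓘(ℝ, ℝ) (fun p => a p i) x
      ((EuclideanSpace.proj i : Vec m →L[ℝ] ℝ).comp (mfderiv (𝓡 m) 𝓘(ℝ, Vec m) a x)) := fun i =>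
    ((EuclideanSpace.proj i : Vec m →L[ℝ] ℝ).hasMFDerivAt).comp x ha.hasMFDerivAt
  have hσ := fun i : Fin m => mdifferentiableAt_frameField hx
    (mdifferentiableAt_const (c := EuclideanSpace.single i (1 : ℝ)) (I := 𝓡 m) (x := x))
  have h2 : (tangentTriv y).symmL ℝ x (mvfderiv (𝓡 m) a x u)
      = ∑ i, (mvfderiv (𝓡 m) a x u) i •
        frameField y (fun _ => EuclideanSpace.single i (1 : ℝ)) x :=
    congrFun (frameField_eq_sum y fun _ => mvfderiv (𝓡 m) a x u) x
  have h3 : ∀ i, mvfderiv (𝓡 m) (fun p => a p i) x u = (mvfderiv (𝓡 m) a x u) i := by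
    intro i
    simp only [mvfderiv, (hg i).mfderiv]
    rfl
  have h4 : ∀ i, mvfderiv (𝓡 m) (fun _ : M => a x i) x u = 0 := by
    intro i
    simp [mvfderiv, mfderiv_const]
  rw [h2, frameField_eq_sum y a, frameField_eq_sum y (fun _ => a x),
    nabla_sum_smul nabla _ _ _ (fun i => (hg i).mdifferentiableAt) hσ,
    nabla_sum_smul nabla _ _ _ (fun i => mdifferentiableAt_const) hσ,
    Finset.sum_add_distrib, Finset.sum_add_distrib]
  simp only [h3, h4, zero_smul, Finset.sum_const_zero, add_zero]
  exact add_comm _ _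

/-- The covariant derivative is local. The axioms of `nabla` say nothing about
non-differentiable fields, whence the assumption on `τ`. -/
lemma nabla_congr {x : M} {σ τ : ∀ p : M, TangentSpace (𝓡 m) p}
    (hτ : MDifferentiableAt (𝓡 m) (𝓡 m).tangent
      (fun p => (⟨p, τ p⟩ : TangentBundle (𝓡 m) M)) x) (h : ∀ᶠ p in 𝓝 x, σ p = τ p) :
    nabla σ x = nabla τ x := by
  have hσ : MDifferentiableAt (𝓡 m) (𝓡 m).tangent
      (fun p => (⟨p, σ p⟩ : TangentBundle (𝓡 m) M)) x := by
    refine hτ.congr_of_eventuallyEq ?_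
    filter_upwards [h] with p hp
    rw [hp]
  exact nabla.isCovariantDerivativeOnUniv.congr_of_eventuallyEq hσ hτ Filter.univ_mem h

/-- The Christoffel map of the chart at `y`: the coefficients, in its coordinate frame, of
`∇_U V` at `p`, where `U` and `V` have the constant coefficients `u` and `v`. -/
def christoffel (y p : M) (v u : Vec m) : Vec m :=
  (tangentTriv y ⟨p, nabla (frameField y fun _ => v) p (frameField y (fun _ => u) p)⟩).2

lemma symmL_christoffel {y p : M} (hp : p ∈ (chartAt (Vec m) y).source) (v u : Vec m) :
    (tangentTriv y).symmL ℝ p (christoffel nabla y p v u)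
      = nabla (frameField y fun _ => v) p ((tangentTriv y).symmL ℝ p u) :=  by
  have hb : p ∈ (tangentTriv y).baseSet := hp
  rw [Trivialization.symmL_apply (R := ℝ) (tangentTriv (m := m) y) hb]
  exact (tangentTriv y).symm_apply_apply_mk hb _

/-- The Christoffel map as a bilinear map, assembled from its values on the standard basis. -/
def christoffelBilin (y p : M) : Vec m →L[ℝ] Vec m →L[ℝ] Vec m :=
  ∑ i, ∑ j, (EuclideanSpace.proj i : Vec m →L[ℝ] ℝ).smulRight
    ((EuclideanSpace.proj j : Vec m →L[ℝ] ℝ).smulRight (christoffel nabla y p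
      (EuclideanSpace.single i 1) (EuclideanSpace.single j 1)))

lemma christoffelBilin_apply {y p : M} (hp : p ∈ (chartAt (Vec m) y).source) (v u : Vec m) :
    christoffelBilin nabla y p v u = christoffel nabla y p v u := by
  have hb : p ∈ (tangentTriv y).baseSet := hp
  have key : ∀ z : TangentSpace (𝓡 m) p, (tangentTriv y ⟨p, z⟩).2
      = (tangentTriv y).continuousLinearMapAt ℝ p z := fun z =>
    (Trivialization.continuousLinearMapAt_apply_of_mem (R := ℝ) (tangentTriv (m := m) y) hb z).symm
  have hσ := fun i : Fin m => mdifferentiableAt_frameField hp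
    (mdifferentiableAt_const (c := EuclideanSpace.single i (1 : ℝ)) (I := 𝓡 m) (x := p))
  have h4 : ∀ i, mvfderiv (𝓡 m) (fun _ : M => v i) p (frameField y (fun _ => u) p) = 0 := by
    intro i
    simp [mvfderiv, mfderiv_const]
  have hu : frameField y (fun _ => u) p = ∑ j, u j •
      frameField y (fun _ => EuclideanSpace.single j (1 : ℝ)) p :=
    congrFun (frameField_eq_sum y fun _ => u) p
  unfold christoffel
  rw [key, frameField_eq_sum y (fun _ => v),
    nabla_sum_smul nabla _ _ _ (fun i => mdifferentiableAt_const) hσ]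
  simp only [h4, zero_smul, add_zero]
  rw [hu]
  simp only [map_sum, map_smul, Finset.smul_sum]
  simp only [christoffelBilin, christoffel, key]
  simp

/-- Smoothness of `nabla` is a condition on global sections, so the local frame is cut off by a
bump function at the point considered. -/
lemma contMDiffAt_christoffel [T2Space M]
    [CovariantDerivative.ContMDiffCovariantDerivative nabla ∞] {y p : M}
    (hp : p ∈ (chartAt (Vec m) y).source) (v u : Vec m) :
    ContMDiffAt (𝓡 m) 𝓘(ℝ, Vec m) ∞ (fun q => christoffel nabla y q v u) p := by
  have hopen : IsOpen (chartAt (Vec m) y).source := (chartAt (Vec m) y).open_source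
  obtain ⟨ρ, hρ, -⟩ := (SmoothBumpFunction.nhds_basis_support (I := 𝓡 m)
    (hopen.mem_nhds hp)).mem_iff.1 (hopen.mem_nhds hp)
  have hframe : ∀ w : Vec m, ContMDiffOn (𝓡 m) (𝓡 m).tangent ∞
      (fun q => (⟨q, frameField y (fun _ => w) q⟩ : TangentBundle (𝓡 m) M))
      (chartAt (Vec m) y).source := fun w q hq =>
    (contMDiffAt_frameField hq contMDiffAt_const).contMDiffWithinAt
  have hglob : ContMDiff (𝓡 m) (𝓡 m).tangent ∞
      (fun q => (⟨q, ((ρ : M → ℝ) • frameField y fun _ => v) q⟩ : TangentBundle (𝓡 m) M)) :=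
    ContMDiffOn.smul_section_of_tsupport ρ.contMDiff.contMDiffOn hopen hρ (hframe v)
  have hcov := (CovariantDerivative.ContMDiffCovariantDerivative.contMDiff
    (cov := nabla) (k := ∞)).contMDiff hglob.contMDiffOn
  have happ := (hcov.contMDiffAt Filter.univ_mem).clm_bundle_apply
    ((hframe u).contMDiffAt (hopen.mem_nhds hp))
  have hcoord := ((tangentTriv y).contMDiffAt_section_iff (IB := 𝓡 m) (x₀ := p)
    (s := fun q => nabla ((ρ : M → ℝ) • frameField y fun _ => v) q
      (frameField y (fun _ => u) q)) hp).1 happ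
  refine hcoord.congr_of_eventuallyEq ?_
  filter_upwards [hopen.mem_nhds hp, ρ.eventuallyEq_one.eventuallyEq_nhds] with q hq hq1
  have : nabla ((ρ : M → ℝ) • frameField y fun _ => v) q
      = nabla (frameField y fun _ => v) q := by
    refine nabla_congr nabla (mdifferentiableAt_frameField hq mdifferentiableAt_const) ?_
    filter_upwards [hq1] with r hr
    simp [hr]
  rw [this]
  rfl

/-- The Christoffel map as a function on the target of the chart. -/
def chartChristoffel (y : M) (x : Vec m) : Vec m →L[ℝ] Vec m →L[ℝ] Vec m :=
  christoffelBilin nabla y ((chartAt (Vec m) y).symm x)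

lemma contDiffAt_chartChristoffel [T2Space M]
    [CovariantDerivative.ContMDiffCovariantDerivative nabla ∞] {y : M} {x : Vec m}
    (hx : x ∈ (chartAt (Vec m) y).target) : ContDiffAt ℝ ∞ (chartChristoffel nabla y) x := by
  have hsymm : ContMDiffAt (𝓡 m) (𝓡 m) ∞ (chartAt (Vec m) y).symm x :=
    contMDiffOn_chart_symm.contMDiffAt ((chartAt (Vec m) y).open_target.mem_nhds hx)
  have h : ∀ v u, ContDiffAt ℝ ∞
      (fun x => christoffel nabla y ((chartAt (Vec m) y).symm x) v u) x := fun v u =>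
    ((contMDiffAt_christoffel nabla ((chartAt (Vec m) y).map_target hx) v u).comp x
      hsymm).contDiffAt
  unfold chartChristoffel christoffelBilin
  refine ContDiffAt.sum fun i _ => ContDiffAt.sum fun j _ => ?_
  exact contDiffAt_const.smulRight (contDiffAt_const.smulRight (h _ _))

/-! ### The geodesic equation in a chart -/

lemma mdifferentiableAt_chartAt {y p : M} (hp : p ∈ (chartAt (Vec m) y).source) :
    MDifferentiableAt (𝓡 m) 𝓘(ℝ, Vec m) (chartAt (Vec m) y) p :=
  (contMDiffOn_chart.contMDiffAt ((chartAt (Vec m) y).open_source.mem_nhds hp)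
    (n := ∞)).mdifferentiableAt (by simp)

lemma tangentTriv_apply {y p : M} (hp : p ∈ (chartAt (Vec m) y).source)
    (z : TangentSpace (𝓡 m) p) :
    (tangentTriv y ⟨p, z⟩).2 = mvfderiv (𝓡 m) (chartAt (Vec m) y) p z := by
  have hb : p ∈ (tangentTriv y).baseSet := hp
  rw [← Trivialization.continuousLinearMapAt_apply_of_mem (R := ℝ) (tangentTriv (m := m) y) hb z]
  exact congrArg (fun L => L z) (TangentBundle.continuousLinearMapAt_trivializationAt hp)

/-- The coefficients of the velocity in a coordinate frame are the derivatives of the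
coordinates. -/
lemma tangentTriv_velocity {y : M} {γ : ℝ → M} {t : ℝ}
    (ht : γ t ∈ (chartAt (Vec m) y).source) (hγ : MDifferentiableAt 𝓘(ℝ, ℝ) (𝓡 m) γ t) :
    (tangentTriv y ⟨γ t, velocity γ t⟩).2 = deriv (fun s => chartAt (Vec m) y (γ s)) t := by
  rw [tangentTriv_apply ht]
  exact (hasDerivAt_comp_curve (mdifferentiableAt_chartAt ht) hγ).deriv.symm

lemma symmL_tangentTriv {y p : M} (hp : p ∈ (chartAt (Vec m) y).source)
    (z : TangentSpace (𝓡 m) p) :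
    (tangentTriv y).symmL ℝ p (tangentTriv y ⟨p, z⟩).2 = z := by
  have hb : p ∈ (tangentTriv y).baseSet := hp
  rw [Trivialization.symmL_apply (R := ℝ) (tangentTriv (m := m) y) hb]
  exact (tangentTriv y).symm_apply_apply_mk hb _

lemma symmL_injective {y p : M} (hp : p ∈ (chartAt (Vec m) y).source) :
    Injective ((tangentTriv (m := m) y).symmL ℝ p) := by
  have hb : p ∈ (tangentTriv y).baseSet := hp
  intro v w h
  have h1 := tangentTriv_frameField hp fun _ => v
  have h2 := tangentTriv_frameField hp fun _ => w
  simp only [frameField] at h1 h2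
  rw [← h1, ← h2, h]

/-- The covariant derivative along a curve can be computed in the coordinate frame of any chart
around the point, not only in the one of the preferred chart there. -/
lemma covariantDerivAlong_eq {y : M} {γ : ℝ → M} {V : ∀ t, TangentSpace (𝓡 m) (γ t)} {t : ℝ}
    (ht : γ t ∈ (chartAt (Vec m) y).source) (hγ : MDifferentiableAt 𝓘(ℝ, ℝ) (𝓡 m) γ t)
    (hV : DifferentiableAt ℝ (fun s => (tangentTriv y ⟨γ s, V s⟩).2) t) :
    covariantDerivAlong nabla γ V t
      = (tangentTriv y).symmL ℝ (γ t) (deriv (fun s => (tangentTriv y ⟨γ s, V s⟩).2) t)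
        + nabla (frameField y fun _ => (tangentTriv y ⟨γ t, V t⟩).2) (γ t) (velocity γ t) := by
  set z := γ t with hz
  have hzz : z ∈ (chartAt (Vec m) z).source := mem_chart_source _ _
  set A : M → Vec m →L[ℝ] Vec m := fun p =>
    ((tangentTriv (m := m) y).coordChangeL ℝ (tangentTriv (m := m) z) p : Vec m →L[ℝ] Vec m) with hA
  set w : ℝ → Vec m := fun s => (tangentTriv y ⟨γ s, V s⟩).2 with hw
  set v : ℝ → Vec m := fun s => (tangentTriv z ⟨γ s, V s⟩).2 with hv
  have hopen : (chartAt (Vec m) y).source ∩ (chartAt (Vec m) z).source ∈ 𝓝 z :=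
    ((chartAt (Vec m) y).open_source.inter (chartAt (Vec m) z).open_source).mem_nhds ⟨ht, hzz⟩
  have hAap : ∀ p ∈ (chartAt (Vec m) y).source ∩ (chartAt (Vec m) z).source, ∀ b : Vec m,
      A p b = (tangentTriv z ⟨p, (tangentTriv y).symmL ℝ p b⟩).2 := by
    intro p hp b
    rw [Trivialization.symmL_apply (R := ℝ) (tangentTriv (m := m) y) hp.1]
    exact Trivialization.coordChangeL_apply (R := ℝ) (tangentTriv (m := m) y) (tangentTriv z) hp b
  have hAd : MDifferentiableAt (𝓡 m) 𝓘(ℝ, Vec m →L[ℝ] Vec m) A z :=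
    ((contMDiffOn_coordChangeL (n := ∞) (IB := 𝓡 m) (tangentTriv y)
      (tangentTriv z)).contMDiffAt hopen).mdifferentiableAt (by simp)
  have hAγ : HasDerivAt (fun s => A (γ s)) (mvfderiv (𝓡 m) A z (velocity γ t)) t := by
    exact hasDerivAt_comp_curve hAd hγ
  have hvw : v =ᶠ[𝓝 t] fun s => A (γ s) (w s) := by
    filter_upwards [hγ.continuousAt.preimage_mem_nhds hopen] with s hs
    rw [hAap _ hs, symmL_tangentTriv hs.1]
  have hdv : deriv v t = mvfderiv (𝓡 m) A z (velocity γ t) (w t) + A z (deriv w t) := by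
    rw [hvw.deriv_eq]
    exact (hAγ.clm_apply hV.hasDerivAt).deriv
  have hAw : MDifferentiableAt (𝓡 m) 𝓘(ℝ, Vec m) (fun p => A p (w t)) z :=
    hAd.clm_apply mdifferentiableAt_const
  have hAw' : mvfderiv (𝓡 m) (fun p => A p (w t)) z (velocity γ t)
      = mvfderiv (𝓡 m) A z (velocity γ t) (w t) := by
    have h := ((ContinuousLinearMap.apply ℝ (Vec m) (w t)).hasMFDerivAt (x := A z)).comp z
      hAd.hasMFDerivAt
    have h' := h.mfderiv
    simp only [mvfderiv]
    erw [h']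
    rfl
  have hvt : v t = A z (w t) := hvw.eq_of_nhds
  -- The constant coefficients `w t` at `y` become the coefficients `A p (w t)` at `z`; their
  -- derivative accounts for the derivative of the transition map in `hdv`.
  have hfield : nabla (frameField y fun _ => w t) z = nabla (frameField z fun p => A p (w t)) z := by
    refine nabla_congr nabla (mdifferentiableAt_frameField hzz hAw) ?_
    filter_upwards [hopen] with p hp
    simp only [frameField]
    rw [hAap p hp, symmL_tangentTriv hp.2]
  have hcong : nabla (fun p => (tangentTriv z).symm p (v t)) z
      = nabla (frameField z fun _ => v t) z := by
    refine nabla_congr nabla (mdifferentiableAt_frameField hzz mdifferentiableAt_const) ?_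
    filter_upwards [(chartAt (Vec m) z).open_source.mem_nhds hzz] with p hp
    rw [frameField_apply hp]
  have hlast : (tangentTriv z).symmL ℝ z (A z (deriv w t))
      = (tangentTriv y).symmL ℝ z (deriv w t) := by
    rw [hAap z ⟨ht, hzz⟩, symmL_tangentTriv hzz]
  have hdef : covariantDerivAlong nabla γ V t
      = (tangentTriv z).symm z (deriv v t)
        + nabla (fun p => (tangentTriv z).symm p (v t)) z (velocity γ t) := rfl
  rw [hdef, hcong, hfield, nabla_frameField nabla hzz hAw, hAw', ← hvt, ← hlast,
    ← Trivialization.symmL_apply (R := ℝ) (tangentTriv (m := m) z) hzz, hdv, map_add]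
  abel

lemma contDiffAt_chartAt_comp {y : M} {γ : ℝ → M} {t : ℝ} {n : WithTop ℕ∞} (hn : n ≤ ∞)
    (ht : γ t ∈ (chartAt (Vec m) y).source) (hγ : ContMDiffAt 𝓘(ℝ, ℝ) (𝓡 m) n γ t) :
    ContDiffAt ℝ n (fun s => chartAt (Vec m) y (γ s)) t := by
  have h : ContMDiffAt (𝓡 m) (𝓡 m) n (chartAt (Vec m) y) (γ t) :=
    (contMDiffOn_chart.contMDiffAt ((chartAt (Vec m) y).open_source.mem_nhds ht)
      (n := ∞)).of_le hn
  exact (h.comp t hγ).contDiffAt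

/-- The geodesic equation `x'' + Γ(x)(x', x') = 0` in the coordinates `x` of any chart. -/
lemma covariantDerivAlong_velocity_eq_zero_iff {y : M} {γ : ℝ → M} {t : ℝ}
    (ht : γ t ∈ (chartAt (Vec m) y).source) (hγ : ContMDiffAt 𝓘(ℝ, ℝ) (𝓡 m) 2 γ t)
    {c : ℝ → Vec m} (hc : c = fun s => chartAt (Vec m) y (γ s)) :
    covariantDerivAlong nabla γ (velocity γ) t = 0 ↔
      deriv (deriv c) t = -chartChristoffel nabla y (c t) (deriv c t) (deriv c t) := by
  have hcd : ContDiffAt ℝ 2 c t := hc ▸ contDiffAt_chartAt_comp ENat.LEInfty.out ht hγ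
  have hcd' : DifferentiableAt ℝ (deriv c) t :=
    (ContDiffAt.derivWithin (m := 1) hcd (by norm_num)).differentiableAt (by simp)
  have hev : (fun s => (tangentTriv y ⟨γ s, velocity γ s⟩).2) =ᶠ[𝓝 t] deriv c := by
    filter_upwards [(contMDiffAt_iff_contMDiffAt_nhds (by simp)).1 hγ,
      hγ.continuousAt.preimage_mem_nhds ((chartAt (Vec m) y).open_source.mem_nhds ht)] with s hs hs'
    rw [hc, tangentTriv_velocity hs' (hs.mdifferentiableAt (by simp))]
  have hmd := hγ.mdifferentiableAt (by simp)
  have hvel : velocity γ t = (tangentTriv y).symmL ℝ (γ t) (deriv c t) := by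
    rw [← hev.eq_of_nhds, symmL_tangentTriv ht]
  have hcoef := hev.eq_of_nhds
  have hct : (chartAt (Vec m) y).symm (c t) = γ t := by
    rw [hc]; exact (chartAt (Vec m) y).left_inv ht
  rw [covariantDerivAlong_eq nabla ht hmd (hcd'.congr_of_eventuallyEq hev), hev.deriv_eq]
  rw [hcoef, hvel, ← symmL_christoffel nabla ht, ← map_add, eq_neg_iff_add_eq_zero,
    chartChristoffel, hct, christoffelBilin_apply nabla ht]
  exact map_eq_zero_iff ((tangentTriv (m := m) y).symmL ℝ (γ t)) (symmL_injective ht)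

end Connection

/-! ### Differential equations with quadratic right-hand side -/

section ODE

variable {E : Type*} [NormedAddCommGroup E] [NormedSpace ℝ E]

lemma exists_eventually_norm_le {X F : Type*} [TopologicalSpace X] [NormedAddCommGroup F]
    {f : X → F} {x : X} (hf : ContinuousAt f x) : ∃ K > (0 : ℝ), ∀ᶠ y in 𝓝 x, ‖f y‖ ≤ K :=
  ⟨‖f x‖ + 1, by positivity,
    (hf.norm.eventually_lt continuousAt_const (lt_add_one _)).mono fun _ hy => hy.le⟩

/-- Solutions that start near `z₀` stay, for a uniform time, in a given neighbourhood of `z₀`. -/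
lemma exists_solution_mem [CompleteSpace E] {f : E → E} {z₀ : E} (hf : ContDiffAt ℝ 1 f z₀)
    {V : Set E} (hV : V ∈ 𝓝 z₀) :
    ∃ r > (0 : ℝ), ∃ ε > (0 : ℝ), ∀ z ∈ Metric.closedBall z₀ r, ∃ α : ℝ → E, α 0 = z ∧
      ∀ t ∈ Ioo (-ε) ε, HasDerivAt α (f (α t)) t ∧ α t ∈ V := by
  obtain ⟨ε, hε, a, r, K, L, hr, hpl⟩ := IsPicardLindelof.of_contDiffAt_one hf
  obtain ⟨α, hα, hcont⟩ :=
    (hpl 0).exists_forall_mem_closedBall_eq_hasDerivWithinAt_continuousOn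
  have hnhds : Metric.closedBall z₀ r ×ˢ Icc (0 - ε) (0 + ε) ∈ 𝓝 (z₀, (0 : ℝ)) :=
    prod_mem_nhds (Metric.closedBall_mem_nhds _ hr) (Icc_mem_nhds (by linarith) (by linarith))
  have hα0 : α (z₀, 0) = z₀ := (hα z₀ (Metric.mem_closedBall_self hr.le)).1
  have hat : ContinuousAt α (z₀, 0) := hcont.continuousAt hnhds
  have hpre : α ⁻¹' V ∩ Metric.closedBall z₀ r ×ˢ Icc (0 - ε) (0 + ε) ∈ 𝓝 (z₀, (0 : ℝ)) :=
    Filter.inter_mem (hat.preimage_mem_nhds (by rwa [hα0])) hnhds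
  obtain ⟨A, hA, T, hT, hAT⟩ := mem_nhds_prod_iff.1 hpre
  obtain ⟨r', hr', hrA⟩ := Metric.nhds_basis_closedBall.mem_iff.1 hA
  obtain ⟨ε', hε', hεT⟩ := Metric.nhds_basis_ball.mem_iff.1 hT
  refine ⟨r', hr', min ε ε', lt_min hε hε', fun z hz => ⟨fun t => α (z, t), ?_, fun t ht => ?_⟩⟩
  · have hm := hAT (show (z, (0 : ℝ)) ∈ A ×ˢ T from ⟨hrA hz, hεT (Metric.mem_ball_self hε')⟩)
    exact (hα z hm.2.1).1
  · have hmin := min_le_left ε ε'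
    have hmin' := min_le_right ε ε'
    have htT : t ∈ T := hεT (by
      rw [Metric.mem_ball, Real.dist_eq, sub_zero, abs_lt]
      constructor <;> linarith [ht.1, ht.2])
    have hm := hAT (show (z, t) ∈ A ×ˢ T from ⟨hrA hz, htT⟩)
    refine ⟨((hα z hm.2.1).2 t hm.2.2).hasDerivAt
      (Icc_mem_nhds (by linarith [ht.1]) (by linarith [ht.2])), hm.1⟩

/-- Local uniqueness for a continuously differentiable vector field. -/
lemma eventuallyEq_of_hasDerivAt {F : E → E} {f g : ℝ → E} {t : ℝ}
    (hF : ContDiffAt ℝ 1 F (f t)) (hf : ∀ᶠ s in 𝓝 t, HasDerivAt f (F (f s)) s)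
    (hg : ∀ᶠ s in 𝓝 t, HasDerivAt g (F (g s)) s) (h : f t = g t) : f =ᶠ[𝓝 t] g := by
  obtain ⟨K, s, hs, hl⟩ := hF.exists_lipschitzOnWith
  refine ODE_solution_unique_of_eventually (v := fun _ => F) (s := fun _ => s) (K := K)
    (Filter.Eventually.of_forall fun _ => hl) ?_ ?_ h
  · exact hf.and (hf.self_of_nhds.continuousAt.preimage_mem_nhds hs)
  · exact hg.and (hg.self_of_nhds.continuousAt.preimage_mem_nhds (h ▸ hs))

/-- The vector field on `E × E` of the second order equation `x'' = -B(x)(x', x')`. -/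
def quadraticField (B : E → E →L[ℝ] E →L[ℝ] E) (z : E × E) : E × E :=
  (z.2, -B z.1 z.2 z.2)

lemma contDiffAt_quadraticField {B : E → E →L[ℝ] E →L[ℝ] E} {z : E × E}
    (hB : ContDiffAt ℝ 1 B z.1) : ContDiffAt ℝ 1 (quadraticField B) z := by
  have h : ContDiffAt ℝ 1 (fun z : E × E => B z.1) z := hB.comp z contDiffAt_fst
  exact contDiffAt_snd.prodMk ((h.clm_apply contDiffAt_snd).clm_apply contDiffAt_snd).neg

/-- The equation `x'' = -B(x)(x', x')` with `x(0) = p`, `x'(0) = v` has, for `p` near `x₀` and `v`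
small, a solution until after time `1`, and `x(1) = p + v + O(‖v‖²)` uniformly in `p`. -/
lemma exists_quadratic_solution [CompleteSpace E] {B : E → E →L[ℝ] E →L[ℝ] E} {x₀ : E}
    (hB : ContDiffAt ℝ 1 B x₀) {U : Set E} (hU : U ∈ 𝓝 x₀) :
    ∃ C > (0 : ℝ), ∃ r > (0 : ℝ), ∀ p v : E, ‖p - x₀‖ ≤ r → ‖v‖ ≤ r →
      ∃ x u : ℝ → E, x 0 = p ∧ u 0 = v ∧
        (∀ t ∈ Ioo (-2 : ℝ) 2, x t ∈ U ∧ HasDerivAt x (u t) t ∧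
          HasDerivAt u (-B (x t) (u t) (u t)) t) ∧
        ‖x 1 - p - v‖ ≤ C * ‖v‖ ^ 2 := by
  obtain ⟨K, hK0, hK⟩ : ∃ K > (0 : ℝ), ∀ᶠ x in 𝓝 x₀, ‖B x‖ ≤ K := by
    -- Instance search does not find this structure in reasonable time.
    let _ : NormedAddCommGroup (E →L[ℝ] E →L[ℝ] E) := ContinuousLinearMap.toNormedAddCommGroup
    exact exists_eventually_norm_le hB.continuousAt
  have hV : (U ∩ {x | ‖B x‖ ≤ K}) ×ˢ Metric.closedBall (0 : E) 1 ∈ 𝓝 (x₀, (0 : E)) :=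
    prod_mem_nhds (Filter.inter_mem hU hK) (Metric.closedBall_mem_nhds _ one_pos)
  obtain ⟨r, hr, ε, hε, hsol⟩ := exists_solution_mem
    (contDiffAt_quadraticField (z := (x₀, (0 : E))) hB) hV
  -- Slowing a solution down by the factor `s` stretches its life span to `(-2, 2)`.
  set s : ℝ := ε / 2 with hs
  have hs0 : 0 < s := by positivity
  refine ⟨K * Real.exp (2 * (K * s)), by positivity, min r (s * r), lt_min hr (by positivity),
    fun p v hp hv => ?_⟩
  have hz : (p, s⁻¹ • v) ∈ Metric.closedBall (x₀, (0 : E)) r := by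
    rw [Metric.mem_closedBall, Prod.dist_eq, dist_eq_norm, dist_zero_right, norm_smul, norm_inv,
      Real.norm_of_nonneg hs0.le]
    refine max_le (hp.trans (min_le_left _ _)) ?_
    rw [inv_mul_le_iff₀ hs0]
    exact hv.trans (min_le_right _ _)
  obtain ⟨α, hα0, hα⟩ := hsol _ hz
  have hst : ∀ t ∈ Ioo (-2 : ℝ) 2, s * t ∈ Ioo (-ε) ε := fun t ht => by
    constructor <;> nlinarith [ht.1, ht.2]
  set x : ℝ → E := fun t => (α (s * t)).1 with hx
  set u : ℝ → E := fun t => s • (α (s * t)).2 with hu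
  have hmul : ∀ t : ℝ, HasDerivAt (fun t : ℝ => s * t) s t := fun t => by
    simpa using (hasDerivAt_id t).const_mul s
  have hder : ∀ t ∈ Ioo (-2 : ℝ) 2, HasDerivAt x (u t) t ∧
      HasDerivAt u (-B (x t) (u t) (u t)) t := by
    intro t ht
    have h := (hα _ (hst t ht)).1
    have hc : HasDerivAt (fun t => α (s * t)) (s • quadraticField B (α (s * t))) t :=
      h.scomp t (hmul t)
    have h1 := (ContinuousLinearMap.fst ℝ E E).hasFDerivAt.comp_hasDerivAt t hc
    have h2 : HasDerivAt u (s • (s • quadraticField B (α (s * t))).2) t :=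
      ((ContinuousLinearMap.snd ℝ E E).hasFDerivAt.comp_hasDerivAt t hc).const_smul s
    refine ⟨h1, ?_⟩
    convert h2 using 1
    simp [quadraticField, hu, hx]
  have hmem : ∀ t ∈ Ioo (-2 : ℝ) 2, x t ∈ U ∧ ‖B (x t)‖ ≤ K ∧ ‖u t‖ ≤ s := by
    intro t ht
    have h := (hα _ (hst t ht)).2
    refine ⟨h.1.1, h.1.2, ?_⟩
    have h2 : ‖(α (s * t)).2‖ ≤ 1 := by simpa using h.2
    rw [hu, norm_smul, Real.norm_of_nonneg hs0.le]
    nlinarith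
  have hx0 : x 0 = p := by simp [hx, hα0]
  have hu0 : u 0 = v := by simp [hu, hα0, smul_smul, hs0.ne']
  refine ⟨x, u, hx0, hu0, fun t ht => ⟨(hmem t ht).1, hder t ht⟩, ?_⟩
  have hsub : Icc (0 : ℝ) 1 ⊆ Ioo (-2) 2 := fun t ht =>
    ⟨by linarith [ht.1], by linarith [ht.2]⟩
  have hBu : ∀ t ∈ Icc (0 : ℝ) 1, ‖-B (x t) (u t) (u t)‖ ≤ K * ‖u t‖ ^ 2 := by
    intro t ht
    rw [norm_neg]
    calc ‖B (x t) (u t) (u t)‖ ≤ ‖B (x t)‖ * ‖u t‖ * ‖u t‖ := (B (x t)).le_opNorm₂ _ _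
      _ ≤ K * ‖u t‖ * ‖u t‖ := by gcongr; exact (hmem t (hsub ht)).2.1
      _ = K * ‖u t‖ ^ 2 := by ring
  -- The speed grows at most exponentially, since one of the two factors `u` is bounded by `s`.
  have hgron : ∀ t ∈ Icc (0 : ℝ) 1, ‖u t‖ ≤ ‖v‖ * Real.exp (K * s) := by
    intro t ht
    have h := norm_le_gronwallBound_of_norm_deriv_right_le (f := u)
      (f' := fun t => -B (x t) (u t) (u t)) (δ := ‖v‖) (K := K * s) (ε := 0) (a := 0) (b := 1)
      (fun t ht => (hder t (hsub ht)).2.continuousAt.continuousWithinAt)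
      (fun t ht => (hder t (hsub (Ico_subset_Icc_self ht))).2.hasDerivWithinAt)
      (by rw [hu0]) (fun t ht => by
        refine (hBu t (Ico_subset_Icc_self ht)).trans ?_
        rw [add_zero, pow_two, ← mul_assoc]
        gcongr
        exact (hmem t (hsub (Ico_subset_Icc_self ht))).2.2) t ht
    rw [gronwallBound_ε0, sub_zero] at h
    refine h.trans ?_
    exact mul_le_mul_of_nonneg_left
      (Real.exp_le_exp.2 (mul_le_of_le_one_right (by positivity) ht.2)) (norm_nonneg v)
  have hacc : ∀ t ∈ Icc (0 : ℝ) 1,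
      ‖-B (x t) (u t) (u t)‖ ≤ K * Real.exp (2 * (K * s)) * ‖v‖ ^ 2 := by
    intro t ht
    refine (hBu t ht).trans ?_
    have : Real.exp (2 * (K * s)) = Real.exp (K * s) ^ 2 := by rw [← Real.exp_nat_mul]; simp
    rw [this, mul_assoc, ← mul_pow, mul_comm (Real.exp _)]
    gcongr
    exact hgron t ht
  have hvel : ∀ t ∈ Icc (0 : ℝ) 1, ‖u t - v‖ ≤ K * Real.exp (2 * (K * s)) * ‖v‖ ^ 2 := by
    intro t ht
    have h := (convex_Icc (0 : ℝ) 1).norm_image_sub_le_of_norm_hasDerivWithin_le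
      (fun t ht => (hder t (hsub ht)).2.hasDerivWithinAt) hacc (left_mem_Icc.2 zero_le_one) ht
    rw [hu0, sub_zero, Real.norm_of_nonneg ht.1] at h
    exact h.trans (mul_le_of_le_one_right (by positivity) ht.2)
  have h := (convex_Icc (0 : ℝ) 1).norm_image_sub_le_of_norm_hasDerivWithin_le
    (f := fun t => x t - t • v) (f' := fun t => u t - v)
    (fun t ht => ((hder t (hsub ht)).1.sub
      (by simpa using (hasDerivAt_id t).smul_const v)).hasDerivWithinAt)
    hvel (left_mem_Icc.2 zero_le_one) (right_mem_Icc.2 zero_le_one)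
  simp only [hx0, one_smul, zero_smul, sub_zero, norm_one, mul_one] at h
  rwa [sub_right_comm] at h

end ODE

/-! ### Uniqueness of geodesics and the expansion of the exponential map -/

section ChartGeodesics

variable {m : ℕ} {M : Type*} [TopologicalSpace M] [ChartedSpace (Vec m) M]
  [IsManifold (𝓡 m) ∞ M]
variable (nabla : CovariantDerivative (𝓡 m) (Vec m) (TangentSpace (𝓡 m) (M := M)))

/-- `x` is, on the open set of times `J`, a solution with velocity `u` of the geodesic equation
in the chart at `y`. -/
def IsChartGeodesicOn (y : M) (x u : ℝ → Vec m) (J : Set ℝ) : Prop :=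
  ∀ t ∈ J, x t ∈ (chartAt (Vec m) y).target ∧ HasDerivAt x (u t) t ∧
    HasDerivAt u (-chartChristoffel nabla y (x t) (u t) (u t)) t

variable {nabla} {y : M} {x u : ℝ → Vec m} {J : Set ℝ}

lemma IsChartGeodesicOn.contDiffOn [T2Space M]
    [CovariantDerivative.ContMDiffCovariantDerivative nabla ∞]
    (h : IsChartGeodesicOn nabla y x u J) (hJ : IsOpen J) : ContDiffOn ℝ 2 x J := by
  have hx : ContinuousOn x J := fun t ht => (h t ht).2.1.continuousAt.continuousWithinAt
  have hu : ContinuousOn u J := fun t ht => (h t ht).2.2.continuousAt.continuousWithinAt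
  have hΓ : ContinuousOn (fun t => chartChristoffel nabla y (x t)) J := fun t ht =>
    ((contDiffAt_chartChristoffel nabla (h t ht).1).continuousAt.comp
      (h t ht).2.1.continuousAt).continuousWithinAt
  have hu1 : ContDiffOn ℝ 1 u J := by
    rw [show (1 : WithTop ℕ∞) = 0 + 1 from (zero_add 1).symm,
      contDiffOn_succ_iff_deriv_of_isOpen hJ]
    refine ⟨fun t ht => (h t ht).2.2.differentiableAt.differentiableWithinAt, by simp, ?_⟩
    rw [contDiffOn_zero]
    exact ((hΓ.clm_apply hu).clm_apply hu).neg.congr fun t ht => (h t ht).2.2.deriv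
  rw [show (2 : WithTop ℕ∞) = 1 + 1 from one_add_one_eq_two.symm,
    contDiffOn_succ_iff_deriv_of_isOpen hJ]
  exact ⟨fun t ht => (h t ht).2.1.differentiableAt.differentiableWithinAt, by simp,
    hu1.congr fun t ht => (h t ht).2.1.deriv⟩

/-- A solution of the geodesic equation in a chart is a geodesic of the manifold. -/
lemma IsChartGeodesicOn.isGeodesicOn [T2Space M]
    [CovariantDerivative.ContMDiffCovariantDerivative nabla ∞]
    (h : IsChartGeodesicOn nabla y x u J) (hJ : IsOpen J) :
    IsGeodesicOn nabla (fun t => (chartAt (Vec m) y).symm (x t)) J := by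
  have hγ : ContMDiffOn 𝓘(ℝ, ℝ) (𝓡 m) 2 (fun t => (chartAt (Vec m) y).symm (x t)) J :=
    ((contMDiffOn_chart_symm (n := ∞)).of_le ENat.LEInfty.out).comp
      (h.contDiffOn hJ).contMDiffOn fun t ht => (h t ht).1
  refine ⟨hγ, fun t ht => ?_⟩
  have hev : (fun s => chartAt (Vec m) y ((chartAt (Vec m) y).symm (x s))) =ᶠ[𝓝 t] x := by
    filter_upwards [hJ.mem_nhds ht] with s hs
    exact (chartAt (Vec m) y).right_inv (h s hs).1
  have hder : deriv x =ᶠ[𝓝 t] u := by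
    filter_upwards [hJ.mem_nhds ht] with s hs
    exact (h s hs).2.1.deriv
  rw [covariantDerivAlong_velocity_eq_zero_iff nabla
    ((chartAt (Vec m) y).map_target (h t ht).1) (hγ.contMDiffAt (hJ.mem_nhds ht)) rfl,
    hev.deriv.deriv_eq, hev.deriv_eq, hder.deriv_eq, hder.eq_of_nhds, (h t ht).2.2.deriv]
  simp only [(chartAt (Vec m) y).right_inv (h t ht).1]

/-- Conversely, the chart representation of a geodesic solves the geodesic equation. -/
lemma IsGeodesicOn.isChartGeodesicOn {γ : ℝ → M} (h : IsGeodesicOn nabla γ J) (hJ : IsOpen J)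
    {c : ℝ → Vec m} (hc : c = fun s => chartAt (Vec m) y (γ s)) :
    IsChartGeodesicOn nabla y c (deriv c) (J ∩ γ ⁻¹' (chartAt (Vec m) y).source) := by
  rintro t ⟨ht, hts⟩
  have hγ := h.1.contMDiffAt (hJ.mem_nhds ht)
  have hcd : ContDiffAt ℝ 2 c t := hc ▸ contDiffAt_chartAt_comp ENat.LEInfty.out hts hγ
  have hcd' : DifferentiableAt ℝ (deriv c) t :=
    (ContDiffAt.derivWithin (m := 1) hcd (by norm_num)).differentiableAt (by simp)
  refine ⟨?_, (hcd.differentiableAt (by simp)).hasDerivAt, ?_⟩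
  · rw [hc]; exact (chartAt (Vec m) y).map_source hts
  · rw [← (covariantDerivAlong_velocity_eq_zero_iff nabla hts hγ hc).1 (h.2 t ht)]
    exact hcd'.hasDerivAt

/-- Uniqueness: a geodesic of the manifold with the initial data of a solution of the geodesic
equation that stays in a chart coincides with it. It cannot leave the chart earlier, since the set
of times up to which the two agree is both closed and open. -/
lemma IsChartGeodesicOn.eq_of_isGeodesicOn [T2Space M]
    [CovariantDerivative.ContMDiffCovariantDerivative nabla ∞] {γ : ℝ → M} {T : ℝ}
    (h : IsChartGeodesicOn nabla y x u J) (hJ : IsOpen J) (hγ : IsGeodesicOn nabla γ J)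
    (hT : Icc 0 T ⊆ J) (h0T : 0 ≤ T) (h0 : γ 0 = (chartAt (Vec m) y).symm (x 0))
    (h0' : deriv (fun s => chartAt (Vec m) y (γ s)) 0 = u 0) :
    γ T = (chartAt (Vec m) y).symm (x T) := by
  set c : ℝ → Vec m := fun s => chartAt (Vec m) y (γ s) with hc
  have hopen := (chartAt (Vec m) y).open_source
  have hγc : ∀ t ∈ J, ContinuousAt γ t := fun t ht =>
    (hγ.1.contMDiffAt (hJ.mem_nhds ht)).continuousAt
  have hxc : ∀ t ∈ J, ContinuousAt (fun t => (chartAt (Vec m) y).symm (x t)) t := fun t ht =>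
    ((h.isGeodesicOn hJ).1.contMDiffAt (hJ.mem_nhds ht)).continuousAt
  have hcg := hγ.isChartGeodesicOn (y := y) hJ hc
  set S : Set ℝ := {t | γ t = (chartAt (Vec m) y).symm (x t) ∧ deriv c t = u t} with hS
  have hsource : ∀ t ∈ J, γ t = (chartAt (Vec m) y).symm (x t) →
      γ t ∈ (chartAt (Vec m) y).source := fun t ht he => by
    rw [he]; exact (chartAt (Vec m) y).map_target (h t ht).1
  have hclosed : IsClosed (S ∩ Icc 0 T) := by
    refine isClosed_of_closure_subset fun t ht => ?_
    have htI : t ∈ Icc 0 T := closure_minimal inter_subset_right isClosed_Icc ht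
    have htJ := hT htI
    have hfreq := mem_closure_iff_frequently.1 ht
    have h1 : γ t = (chartAt (Vec m) y).symm (x t) :=
      tendsto_nhds_unique_of_frequently_eq (hγc t htJ) (hxc t htJ)
        (hfreq.mono fun s hs => hs.1.1)
    refine ⟨⟨h1, ?_⟩, htI⟩
    exact tendsto_nhds_unique_of_frequently_eq
      (hcg t ⟨htJ, hsource t htJ h1⟩).2.2.continuousAt (h t htJ).2.2.continuousAt
      (hfreq.mono fun s hs => hs.1.2)
  -- Near a time of agreement the curve `γ` still runs in the chart, so both curves solve the same
  -- first order system there.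
  have hopenS : ∀ t ∈ S ∩ Ico 0 T, S ∈ 𝓝[>] t := by
    rintro t ⟨⟨h1, h2⟩, htI⟩
    have htJ := hT (Ico_subset_Icc_self htI)
    have hts := hsource t htJ h1
    have hJ' : J ∩ γ ⁻¹' (chartAt (Vec m) y).source ∈ 𝓝 t :=
      Filter.inter_mem (hJ.mem_nhds htJ) ((hγc t htJ).preimage_mem_nhds (hopen.mem_nhds hts))
    have hcx : c t = x t := by
      simp only [hc, h1, (chartAt (Vec m) y).right_inv (h t htJ).1]
    have heq : (fun s => (c s, deriv c s)) =ᶠ[𝓝 t] fun s => (x s, u s) := by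
      refine eventuallyEq_of_hasDerivAt (F := quadraticField (chartChristoffel nabla y)) ?_ ?_ ?_ ?_
      · exact contDiffAt_quadraticField ((contDiffAt_chartChristoffel nabla
          (hcg t ⟨htJ, hts⟩).1).of_le ENat.LEInfty.out)
      · filter_upwards [hJ'] with s hs
        exact (hcg s hs).2.1.prodMk (hcg s hs).2.2
      · filter_upwards [hJ.mem_nhds htJ] with s hs
        exact (h s hs).2.1.prodMk (h s hs).2.2
      · simp only [hcx, h2]
    refine nhdsWithin_le_nhds ?_
    filter_upwards [heq, hJ'] with s hs hs'
    obtain ⟨hs1, hs2⟩ := Prod.mk.inj hs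
    refine ⟨?_, hs2⟩
    rw [← hs1]
    exact ((chartAt (Vec m) y).left_inv hs'.2).symm
  exact (hclosed.Icc_subset_of_forall_mem_nhdsWithin ⟨h0, h0'⟩ hopenS (right_mem_Icc.2 h0T)).1

/-- The exponential map is computed by any solution in a chart of the geodesic equation. -/
lemma IsChartGeodesicOn.expMap_eq [T2Space M]
    [CovariantDerivative.ContMDiffCovariantDerivative nabla ∞] {ξ : M}
    {v : TangentSpace (𝓡 m) ξ} {a b : ℝ} (ha : a < 0) (hb : 1 < b)
    (h : IsChartGeodesicOn nabla y x u (Ioo a b)) (hξ : ξ ∈ (chartAt (Vec m) y).source)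
    (hx : x 0 = chartAt (Vec m) y ξ) (hu : u 0 = (tangentTriv y ⟨ξ, v⟩).2) :
    v ∈ expDomain nabla ξ ∧ expMap nabla ξ v = (chartAt (Vec m) y).symm (x 1) := by
  have h0 : (0 : ℝ) ∈ Ioo a b := ⟨ha, by linarith⟩
  have hgeo := h.isGeodesicOn isOpen_Ioo
  have hγ0 : (chartAt (Vec m) y).symm (x 0) = ξ := by
    rw [hx, (chartAt (Vec m) y).left_inv hξ]
  have hmd := (hgeo.1.contMDiffAt (isOpen_Ioo.mem_nhds h0)).mdifferentiableAt (by simp)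
  have hdom : v ∈ expDomain nabla ξ := by
    refine ⟨_, ⟨a, b, ha, hb, hgeo⟩, ?_⟩
    have hs : (chartAt (Vec m) y).symm (x 0) ∈ (chartAt (Vec m) y).source := by rwa [hγ0]
    have hv := tangentTriv_velocity (y := y) hs hmd
    have hev : (fun s => chartAt (Vec m) y ((chartAt (Vec m) y).symm (x s))) =ᶠ[𝓝 0] x := by
      filter_upwards [isOpen_Ioo.mem_nhds h0] with s hs
      exact (chartAt (Vec m) y).right_inv (h s hs).1
    rw [hev.deriv_eq, (h 0 h0).2.1.deriv, hu] at hv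
    refine (tangentTriv y).injOn ?_ ?_ (Prod.ext ?_ hv)
    · exact hs
    · exact hξ
    · exact hγ0
  refine ⟨hdom, ?_⟩
  have hex : ∃ γ : ℝ → M, IsExpGeodesic nabla ξ v γ := hdom
  obtain ⟨⟨a', b', ha', hb', hg⟩, hinit⟩ := hex.choose_spec
  rw [expMap, dif_pos hex]
  -- `γ` is the geodesic chosen in the definition of `expMap`; both curves exist on the intersection
  -- of the two intervals.
  set γ := hex.choose with hγdef
  have hsub : Ioo (max a a') (min b b') ⊆ Ioo a b :=
    Ioo_subset_Ioo (le_max_left _ _) (min_le_left _ _)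
  have hsub' : Ioo (max a a') (min b b') ⊆ Ioo a' b' :=
    Ioo_subset_Ioo (le_max_right _ _) (min_le_right _ _)
  have hγ0' : γ 0 = ξ := congrArg TotalSpace.proj hinit
  refine IsChartGeodesicOn.eq_of_isGeodesicOn (J := Ioo (max a a') (min b b')) (T := 1)
    (fun t ht => h t (hsub ht)) isOpen_Ioo
    ⟨hg.1.mono hsub', fun t ht => hg.2 t (hsub' ht)⟩ ?_ zero_le_one (hγ0'.trans hγ0.symm) ?_
  · intro t ht
    exact ⟨(max_lt ha ha').trans_le ht.1, ht.2.trans_lt (lt_min hb hb')⟩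
  · have hmd' := (hg.1.contMDiffAt (isOpen_Ioo.mem_nhds
      (⟨ha', by linarith⟩ : (0 : ℝ) ∈ Ioo a' b'))).mdifferentiableAt (by simp)
    rw [← tangentTriv_velocity (y := y) (hγ0' ▸ hξ) hmd', hu]
    exact congrArg (fun z => (tangentTriv y z).2) hinit

/-- In the chart at `y` the exponential map is `(p, v) ↦ p + v + O(‖v‖²)`, uniformly for `p`
near `y`. -/
theorem expMap_expansion [T2Space M] (nabla : CovariantDerivative (𝓡 m) (Vec m)
      (TangentSpace (𝓡 m) (M := M)))
    [CovariantDerivative.ContMDiffCovariantDerivative nabla ∞] (y : M) :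
    ∃ C > (0 : ℝ), ∃ r > (0 : ℝ), ∀ ξ ∈ (chartAt (Vec m) y).source,
      ‖chartAt (Vec m) y ξ - chartAt (Vec m) y y‖ ≤ r →
      ∀ v : TangentSpace (𝓡 m) ξ, ‖(tangentTriv y ⟨ξ, v⟩).2‖ ≤ r →
        v ∈ expDomain nabla ξ ∧ expMap nabla ξ v ∈ (chartAt (Vec m) y).source ∧
        ‖chartAt (Vec m) y (expMap nabla ξ v) - chartAt (Vec m) y ξ - (tangentTriv y ⟨ξ, v⟩).2‖
          ≤ C * ‖(tangentTriv y ⟨ξ, v⟩).2‖ ^ 2 := by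
  have hy := (chartAt (Vec m) y).map_source (mem_chart_source (Vec m) y)
  obtain ⟨C, hC, r, hr, hsol⟩ := exists_quadratic_solution
    ((contDiffAt_chartChristoffel nabla hy).of_le ENat.LEInfty.out)
    ((chartAt (Vec m) y).open_target.mem_nhds hy)
  refine ⟨C, hC, r, hr, fun ξ hξ hξr v hv => ?_⟩
  obtain ⟨x, u, hx, hu, hode, hest⟩ := hsol _ _ hξr hv
  have hgeo : IsChartGeodesicOn nabla y x u (Ioo (-2) 2) := hode
  obtain ⟨hdom, heq⟩ := hgeo.expMap_eq (by norm_num) (by norm_num) hξ hx hu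
  have h1 := (hode 1 (by norm_num)).1
  refine ⟨hdom, heq ▸ (chartAt (Vec m) y).map_target h1, ?_⟩
  rwa [heq, (chartAt (Vec m) y).right_inv h1]

end ChartGeodesics

/-! ### Second order estimates -/

section Taylor

variable {E F G : Type*} [NormedAddCommGroup E] [NormedSpace ℝ E] [NormedAddCommGroup F]
  [NormedSpace ℝ F] [NormedAddCommGroup G] [NormedSpace ℝ G]

lemma exists_norm_sub_le_mul {f : E → F} {x₀ : E} (hf : ContDiffAt ℝ 1 f x₀) :
    ∃ K > (0 : ℝ), ∀ᶠ x in 𝓝 x₀, ‖f x - f x₀‖ ≤ K * ‖x - x₀‖ := by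
  obtain ⟨K, s, hs, hl⟩ := hf.exists_lipschitzOnWith
  refine ⟨K + 1, by positivity, ?_⟩
  filter_upwards [hs] with x hx
  have h := hl.norm_sub_le hx (mem_of_mem_nhds hs)
  refine h.trans ?_
  gcongr
  linarith

/-- The mean value inequality with the derivative frozen at `x₀`. -/
lemma exists_norm_image_sub_le {Θ : E → F} {x₀ : E} (hΘ : ContDiffAt ℝ 2 Θ x₀) :
    ∃ C > (0 : ℝ), ∃ r > (0 : ℝ), ∀ a b, ‖a - x₀‖ ≤ r → ‖b - x₀‖ ≤ r →
      ‖Θ a - Θ b - fderiv ℝ Θ x₀ (a - b)‖ ≤ C * (‖a - x₀‖ + ‖b - x₀‖) * ‖a - b‖ := by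
  obtain ⟨K, hK, hev⟩ := exists_norm_sub_le_mul (hΘ.fderiv_right (m := 1) (by norm_num))
  have hdiff : ∀ᶠ x in 𝓝 x₀, DifferentiableAt ℝ Θ x :=
    (hΘ.eventually (by simp)).mono fun x hx => hx.differentiableAt (by simp)
  obtain ⟨r, hr, hball⟩ := Metric.nhds_basis_closedBall.mem_iff.1 (hev.and hdiff)
  refine ⟨K, hK, r, hr, fun a b ha hb => ?_⟩
  set ρ := max ‖a - x₀‖ ‖b - x₀‖ with hρ
  have hsub : Metric.closedBall x₀ ρ ⊆ Metric.closedBall x₀ r :=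
    Metric.closedBall_subset_closedBall (max_le ha hb)
  have h := (convex_closedBall x₀ ρ).norm_image_sub_le_of_norm_hasFDerivWithin_le'
    (f := Θ) (f' := fderiv ℝ Θ) (φ := fderiv ℝ Θ x₀) (C := K * ρ) (x := b) (y := a)
    (fun x hx => (hball (hsub hx)).2.hasFDerivAt.hasFDerivWithinAt)
    (fun x hx => (hball (hsub hx)).1.trans (by
      gcongr
      simpa [dist_eq_norm] using hx))
    (by simp [dist_eq_norm, hρ]) (by simp [dist_eq_norm, hρ])
  refine h.trans ?_
  gcongr
  exact max_le (le_add_of_nonneg_right (norm_nonneg _)) (le_add_of_nonneg_left (norm_nonneg _))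

/-- A point `a = x + L κ + O(‖L κ‖²)` has distance `O(‖κ‖)` from `x`. -/
lemma norm_sub_le_of_quadratic {x a : E} {L : F →L[ℝ] E} {κ : F} {B C₁ : ℝ} (hC₁ : 0 ≤ C₁)
    (hL : ‖L‖ ≤ B) (hκ : ‖κ‖ ≤ 1) (ha : ‖a - x - L κ‖ ≤ C₁ * ‖L κ‖ ^ 2) :
    ‖a - x‖ ≤ (B + C₁ * B ^ 2) * ‖κ‖ := by
  have hB : 0 ≤ B := (norm_nonneg L).trans hL
  have hv : ‖L κ‖ ≤ B * ‖κ‖ := L.le_of_opNorm_le hL κ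
  calc ‖a - x‖ = ‖(a - x - L κ) + L κ‖ := by rw [sub_add_cancel]
    _ ≤ C₁ * (B * ‖κ‖) ^ 2 + B * ‖κ‖ := (norm_add_le _ _).trans (add_le_add
        (ha.trans (by gcongr)) hv)
    _ = (B + C₁ * B ^ 2 * ‖κ‖) * ‖κ‖ := by ring
    _ ≤ (B + C₁ * B ^ 2 * 1) * ‖κ‖ := by gcongr
    _ = (B + C₁ * B ^ 2) * ‖κ‖ := by rw [mul_one]

/-- The error of the expansion at a single point: `D` stands for the differential of `Θ` at `x₀`, `L`
and `L₀` for the frame at `x` and at `x₀`, and `A` for the differential of `ε ↦ Θ(x)`. The mixed terms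
`‖ε‖ * ‖κ‖` come from freezing `D` and `L` at `x₀`. -/
lemma norm_remainder_le {Θ : E → F} {x₀ x a : E} {D : E →L[ℝ] F} {L L₀ : F →L[ℝ] E}
    {A : G →L[ℝ] F} {ε : G} {κ : F} {Kg KΛ B C₁ C₂ C₃ : ℝ} (hKΛ : 0 ≤ KΛ)
    (hC₁ : 0 ≤ C₁) (hC₂ : 0 ≤ C₂) (hC₃ : 0 ≤ C₃) (hKg : 0 ≤ Kg) (hD : ∀ κ, D (L₀ κ) = κ)
    (hx : ‖x - x₀‖ ≤ Kg * ‖ε‖) (hL : ‖L‖ ≤ B) (hLL : ‖L - L₀‖ ≤ KΛ * ‖x - x₀‖) (hκ : ‖κ‖ ≤ 1)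
    (ha : ‖a - x - L κ‖ ≤ C₁ * ‖L κ‖ ^ 2)
    (h₁ : ‖Θ a - Θ x - D (a - x)‖ ≤ C₂ * (‖a - x₀‖ + ‖x - x₀‖) * ‖a - x‖)
    (h₂ : ‖Θ x - Θ x₀ - A ε‖ ≤ C₃ * ‖ε‖ ^ 2) :
    ‖Θ a - Θ x₀ - (A ε + κ)‖ ≤
      (C₂ * (B + C₁ * B ^ 2) * (2 * Kg + (B + C₁ * B ^ 2)) + C₃ + ‖D‖ * (C₁ * B ^ 2)
        + ‖D‖ * (KΛ * Kg)) * (‖ε‖ ^ 2 + ‖κ‖ ^ 2) := by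
  have hB : 0 ≤ B := (norm_nonneg L).trans hL
  have hax := norm_sub_le_of_quadratic hC₁ hL hκ ha
  set P : ℝ := B + C₁ * B ^ 2 with hP
  have hP0 : 0 ≤ P := by positivity
  have hv : ‖L κ‖ ≤ B * ‖κ‖ := L.le_of_opNorm_le hL κ
  have ha' : ‖a - x - L κ‖ ≤ C₁ * B ^ 2 * ‖κ‖ ^ 2 := ha.trans (by
    rw [mul_assoc, ← mul_pow]; gcongr)
  have hax0 : ‖a - x₀‖ ≤ P * ‖κ‖ + Kg * ‖ε‖ := by
    rw [← sub_add_sub_cancel a x x₀]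
    exact (norm_add_le _ _).trans (add_le_add hax hx)
  have hprod : ‖ε‖ * ‖κ‖ ≤ ‖ε‖ ^ 2 + ‖κ‖ ^ 2 := by
    nlinarith [sq_nonneg (‖ε‖ - ‖κ‖), sq_nonneg ‖ε‖, sq_nonneg ‖κ‖]
  have hε2 : ‖ε‖ ^ 2 ≤ ‖ε‖ ^ 2 + ‖κ‖ ^ 2 := le_add_of_nonneg_right (sq_nonneg _)
  have hκ2 : ‖κ‖ ^ 2 ≤ ‖ε‖ ^ 2 + ‖κ‖ ^ 2 := le_add_of_nonneg_left (sq_nonneg _)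
  have hT1 : ‖Θ a - Θ x - D (a - x)‖ ≤ C₂ * P * (2 * Kg + P) * (‖ε‖ ^ 2 + ‖κ‖ ^ 2) := by
    refine h₁.trans ?_
    calc C₂ * (‖a - x₀‖ + ‖x - x₀‖) * ‖a - x‖
        ≤ C₂ * ((P * ‖κ‖ + Kg * ‖ε‖) + Kg * ‖ε‖) * (P * ‖κ‖) := by gcongr
      _ = C₂ * P * (2 * Kg * (‖ε‖ * ‖κ‖) + P * ‖κ‖ ^ 2) := by ring
      _ ≤ C₂ * P * (2 * Kg * (‖ε‖ ^ 2 + ‖κ‖ ^ 2) + P * (‖ε‖ ^ 2 + ‖κ‖ ^ 2)) := by gcongr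
      _ = _ := by ring
  have hT2 : ‖Θ x - Θ x₀ - A ε‖ ≤ C₃ * (‖ε‖ ^ 2 + ‖κ‖ ^ 2) := h₂.trans (by gcongr)
  have hT3 : ‖D (a - x - L κ)‖ ≤ ‖D‖ * (C₁ * B ^ 2) * (‖ε‖ ^ 2 + ‖κ‖ ^ 2) := by
    refine (D.le_opNorm _).trans ?_
    rw [mul_assoc]
    exact mul_le_mul_of_nonneg_left (ha'.trans (by gcongr)) (norm_nonneg D)
  have hT4 : ‖D ((L - L₀) κ)‖ ≤ ‖D‖ * (KΛ * Kg) * (‖ε‖ ^ 2 + ‖κ‖ ^ 2) := by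
    refine (D.le_opNorm _).trans ?_
    rw [mul_assoc]
    refine mul_le_mul_of_nonneg_left (((L - L₀).le_opNorm _).trans ?_) (norm_nonneg D)
    calc ‖L - L₀‖ * ‖κ‖ ≤ KΛ * (Kg * ‖ε‖) * ‖κ‖ := by
          gcongr
          exact hLL.trans (by gcongr)
      _ = KΛ * Kg * (‖ε‖ * ‖κ‖) := by ring
      _ ≤ KΛ * Kg * (‖ε‖ ^ 2 + ‖κ‖ ^ 2) := by gcongr
  have hsplit : Θ a - Θ x₀ - (A ε + κ)
      = (Θ a - Θ x - D (a - x)) + (Θ x - Θ x₀ - A ε) + D (a - x - L κ) + D ((L - L₀) κ) := by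
    have hsub : (L - L₀) κ = L κ - L₀ κ := rfl
    rw [hsub, map_sub D (a - x), map_sub D (L κ), hD]
    abel
  rw [hsplit]
  refine (norm_add_le_of_le (norm_add_le_of_le (norm_add_le_of_le hT1 hT2) hT3) hT4).trans
    (le_of_eq ?_)
  ring

/-- The second order expansion behind the error propagation. The point `a` stands for the image of
the vector `Λ(g(ε))κ` at `g(ε)` under an exponential map, and `Θ` for normal coordinates that invert
the frame `Λ` to first order. -/
lemma exists_second_order_bound {Θ : E → F} {g : G → E} {Λ : E → F →L[ℝ] E}
    (hΘ : ContDiffAt ℝ 2 Θ (g 0)) (hg : ContDiffAt ℝ 2 g 0) (hΛ : ContDiffAt ℝ 1 Λ (g 0))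
    (hD : ∀ κ, fderiv ℝ Θ (g 0) (Λ (g 0) κ) = κ) {N : Set E} (hN : N ∈ 𝓝 (g 0)) {C₁ r₁ : ℝ}
    (hC₁ : 0 < C₁) (hr₁ : 0 < r₁) :
    ∃ C > (0 : ℝ), ∃ δ > (0 : ℝ), ∀ ε κ, ‖ε‖ < δ → ‖κ‖ < δ →
      ‖g ε - g 0‖ ≤ r₁ ∧ ‖Λ (g ε) κ‖ ≤ r₁ ∧
      ∀ a, ‖a - g ε - Λ (g ε) κ‖ ≤ C₁ * ‖Λ (g ε) κ‖ ^ 2 →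
        a ∈ N ∧ ‖Θ a - Θ (g 0) - (fderiv ℝ (fun ε => Θ (g ε)) 0 ε + κ)‖
          ≤ C * (‖ε‖ ^ 2 + ‖κ‖ ^ 2) := by
  obtain ⟨Kg, hKg, hg1⟩ := exists_norm_sub_le_mul (hg.of_le one_le_two)
  obtain ⟨KΛ, hKΛ, hΛ1⟩ := exists_norm_sub_le_mul hΛ
  obtain ⟨B, hB, hΛ2⟩ := exists_eventually_norm_le hΛ.continuousAt
  obtain ⟨C₂, hC₂, r₂, hr₂, hΘ1⟩ := exists_norm_image_sub_le hΘ
  obtain ⟨C₃, hC₃, r₃, hr₃, hΨ⟩ := exists_norm_image_sub_le (hΘ.comp 0 hg)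
  obtain ⟨ρ, hρ, hρN⟩ := Metric.nhds_basis_closedBall.mem_iff.1 hN
  have hgc : Filter.Tendsto g (𝓝 0) (𝓝 (g 0)) := hg.continuousAt
  obtain ⟨δ₀, hδ₀, hball⟩ := Metric.nhds_basis_ball.mem_iff.1
    (hg1.and ((hgc.eventually hΛ1).and (hgc.eventually hΛ2)))
  set P : ℝ := B + C₁ * B ^ 2 with hP
  have hP0 : 0 < P := by positivity
  set s : ℝ := min r₁ (min r₂ ρ) with hs
  have hs0 : 0 < s := lt_min hr₁ (lt_min hr₂ hρ)
  have hsr₁ : s ≤ r₁ := min_le_left _ _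
  have hsr₂ : s ≤ r₂ := (min_le_right _ _).trans (min_le_left _ _)
  have hsρ : s ≤ ρ := (min_le_right _ _).trans (min_le_right _ _)
  -- `P * ‖κ‖ + Kg * ‖ε‖` and `B * ‖κ‖` have to stay below `s`.
  set t := s / (Kg + P + B) with ht
  have ht0 : 0 < t := by positivity
  have hts : P * t + Kg * t ≤ s ∧ B * t ≤ s := by
    have h : (Kg + P + B) * t = s := by rw [ht]; field_simp
    have h1 : 0 < B * t := by positivity
    have h2 : 0 < P * t := by positivity
    have h3 : 0 < Kg * t := by positivity
    constructor <;> linarith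
  refine ⟨C₂ * P * (2 * Kg + P) + C₃ + ‖fderiv ℝ Θ (g 0)‖ * (C₁ * B ^ 2)
    + ‖fderiv ℝ Θ (g 0)‖ * (KΛ * Kg), by positivity, min (min δ₀ r₃) (min 1 t), by positivity,
    fun ε κ hε hκ => ?_⟩
  simp only [lt_min_iff] at hε hκ
  obtain ⟨⟨hε0, hε3⟩, hε1, hεt⟩ := hε
  obtain ⟨-, hκ1, hκt⟩ := hκ
  obtain ⟨h1, h2, h3⟩ := hball (by simpa using hε0)
  rw [sub_zero] at h1
  have hxs : P * ‖κ‖ + Kg * ‖ε‖ ≤ s := le_trans (by gcongr) hts.1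
  have hx0 : ‖g ε - g 0‖ ≤ s :=
    h1.trans (le_trans (le_add_of_nonneg_left (by positivity)) hxs)
  refine ⟨hx0.trans hsr₁, ((Λ (g ε)).le_of_opNorm_le h3 κ).trans
    ((le_trans (by gcongr) hts.2).trans hsr₁), fun a ha => ?_⟩
  have hax0 : ‖a - g 0‖ ≤ s := by
    rw [← sub_add_sub_cancel a (g ε) (g 0)]
    exact (norm_add_le _ _).trans
      ((add_le_add (norm_sub_le_of_quadratic hC₁.le h3 hκ1.le ha) h1).trans hxs)
  refine ⟨hρN (by rw [Metric.mem_closedBall, dist_eq_norm]; exact hax0.trans hsρ), ?_⟩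
  refine norm_remainder_le hKΛ.le hC₁.le hC₂.le hC₃.le hKg.le hD h1 h3 h2 hκ1.le ha
    (hΘ1 a (g ε) (hax0.trans hsr₂) (hx0.trans hsr₂)) ?_
  have h := hΨ ε 0 (by rw [sub_zero]; exact hε3.le) (by simpa using hr₃.le)
  simp only [sub_zero, norm_zero, add_zero] at h
  refine h.trans (le_of_eq ?_)
  rw [mul_assoc, ← pow_two]

end Taylor

/-! ### Normal coordinates -/

section NormalCoordinates

variable {m : ℕ} {M : Type*} [TopologicalSpace M] [ChartedSpace (Vec m) M]
  [IsManifold (𝓡 m) ∞ M]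
variable {nabla : CovariantDerivative (𝓡 m) (Vec m) (TangentSpace (𝓡 m) (M := M))}
  {W : ∀ ξ : M, Set (TangentSpace (𝓡 m) ξ)} {ι : ∀ ξ : M, TangentSpace (𝓡 m) ξ ≃L[ℝ] Vec m}

lemma tangentTriv_zero {y ξ : M} (hξ : ξ ∈ (chartAt (Vec m) y).source) :
    (tangentTriv y ⟨ξ, (0 : TangentSpace (𝓡 m) ξ)⟩).2 = 0 := by
  rw [tangentTriv_apply hξ, map_zero]

/-- The constant geodesic, obtained as the case `v = 0` of `expMap_expansion`. -/
lemma expMap_zero [T2Space M] [CovariantDerivative.ContMDiffCovariantDerivative nabla ∞]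
    (y : M) : expMap nabla y 0 = y := by
  obtain ⟨C, -, r, hr, h⟩ := expMap_expansion nabla y
  have hy := mem_chart_source (Vec m) y
  obtain ⟨-, h1, h2⟩ := h y hy (by simpa using hr.le) 0 (by
    rw [tangentTriv_zero hy]; simpa using hr.le)
  rw [tangentTriv_zero hy] at h2
  refine (chartAt (Vec m) y).injOn h1 hy (sub_eq_zero.1 (norm_le_zero_iff.1 ?_))
  simpa using h2

lemma normalCoordInv_normalCoord {ξ ζ : M}
    (hζ : ζ ∈ expMap nabla ξ '' W ξ) :
    normalCoordInv nabla ι ξ (normalCoord nabla W ι ξ ζ) = ζ := by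
  rw [normalCoordInv, normalCoord, ContinuousLinearEquiv.symm_apply_apply]
  exact invFunOn_eq hζ

lemma IsNormalDomain.normalCoord_expMap {ξ : M} (hW : IsNormalDomain nabla ξ (W ξ))
    {v : TangentSpace (𝓡 m) ξ} (hv : v ∈ W ξ) :
    normalCoord nabla W ι ξ (expMap nabla ξ v) = ι ξ v := by
  rw [normalCoord]
  congr 1
  exact hW.injOn.leftInvOn_invFunOn hv

lemma IsNormalDomain.mem_image_self [T2Space M]
    [CovariantDerivative.ContMDiffCovariantDerivative nabla ∞] {ξ : M}
    (hW : IsNormalDomain nabla ξ (W ξ)) : ξ ∈ expMap nabla ξ '' W ξ :=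
  ⟨0, hW.zero_mem, expMap_zero ξ⟩

lemma IsNormalDomain.contMDiffAt_normalCoord [T2Space M]
    [CovariantDerivative.ContMDiffCovariantDerivative nabla ∞] {ξ : M}
    (hW : IsNormalDomain nabla ξ (W ξ)) :
    ContMDiffAt (𝓡 m) 𝓘(ℝ, Vec m) ∞ (normalCoord nabla W ι ξ) ξ := by
  let k : Vec m →L[ℝ] Vec m := (ι ξ : TangentSpace (𝓡 m) ξ →L[ℝ] Vec m)
  exact k.contMDiff.contMDiffAt.comp ξ
    (hW.contMDiffOn_inv.contMDiffAt (hW.isOpen_image.mem_nhds hW.mem_image_self))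

lemma IsNormalDomain.contMDiffAt_normalCoordInv {ξ : M} (hW : IsNormalDomain nabla ξ (W ξ)) :
    ContMDiffAt 𝓘(ℝ, Vec m) (𝓡 m) ∞ (normalCoordInv nabla ι ξ) 0 := by
  let k : Vec m →L[ℝ] Vec m := ((ι ξ).symm : Vec m →L[ℝ] TangentSpace (𝓡 m) ξ)
  have hk : k 0 = 0 := map_zero k
  have hopen : @IsOpen (Vec m) _ (W ξ) := hW.isOpen
  have h0 : (0 : Vec m) ∈ W ξ := hW.zero_mem
  have h : ContMDiffAt 𝓘(ℝ, Vec m) (𝓡 m) ∞ (fun v : Vec m => expMap nabla ξ v) (k 0) := by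
    rw [hk]
    exact hW.contMDiffOn.contMDiffAt (hopen.mem_nhds h0)
  exact h.comp (0 : Vec m) k.contMDiff.contMDiffAt

lemma normalCoordInv_zero [T2Space M]
    [CovariantDerivative.ContMDiffCovariantDerivative nabla ∞] (ξ : M) :
    normalCoordInv nabla ι ξ 0 = ξ := by
  rw [normalCoordInv, map_zero, expMap_zero]

/-- The frame `ι_ξ⁻¹`, read in the chart at `y`. -/
def chartFrame (ι : ∀ ξ : M, TangentSpace (𝓡 m) ξ ≃L[ℝ] Vec m) (y : M) (x : Vec m) :
    Vec m →L[ℝ] Vec m :=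
  ∑ i, (EuclideanSpace.proj i : Vec m →L[ℝ] ℝ).smulRight
    (tangentTriv y ⟨(chartAt (Vec m) y).symm x,
      (ι ((chartAt (Vec m) y).symm x)).symm (EuclideanSpace.single i 1)⟩).2

lemma chartFrame_apply {y ξ : M} (hξ : ξ ∈ (chartAt (Vec m) y).source) (κ : Vec m) :
    chartFrame ι y (chartAt (Vec m) y ξ) κ = (tangentTriv y ⟨ξ, (ι ξ).symm κ⟩).2 := by
  have hκ : κ = ∑ i, κ i • EuclideanSpace.single i (1 : ℝ) := by
    simpa using ((EuclideanSpace.basisFun (Fin m) ℝ).sum_repr κ).symm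
  have hsum : (ι ξ).symm κ = ∑ i, κ i • (ι ξ).symm (EuclideanSpace.single i (1 : ℝ)) := by
    conv_lhs => rw [hκ]
    simp only [map_sum, map_smul]
  -- The base point is replaced together with the vector over it.
  have hbase : ∀ p, p = ξ → ∀ w : Vec m,
      (tangentTriv y ⟨p, (ι p).symm w⟩).2 = (tangentTriv y ⟨ξ, (ι ξ).symm w⟩).2 := by
    rintro p rfl w
    rfl
  rw [hsum, tangentTriv_apply hξ]
  simp only [chartFrame, sum_apply, ContinuousLinearMap.smulRight_apply,
    map_sum, map_smul, hbase _ ((chartAt (Vec m) y).left_inv hξ), tangentTriv_apply hξ]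
  rfl

lemma contDiffAt_chartFrame {y : M}
    (hι : ∀ w : Vec m, ContMDiffAt (𝓡 m) (𝓡 m).tangent 1
      (fun ξ => (⟨ξ, (ι ξ).symm w⟩ : TangentBundle (𝓡 m) M)) y) :
    ContDiffAt ℝ 1 (chartFrame ι y) (chartAt (Vec m) y y) := by
  have hy := mem_chart_source (Vec m) y
  have hsymm : ContMDiffAt (𝓡 m) (𝓡 m) 1 (chartAt (Vec m) y).symm (chartAt (Vec m) y y) :=
    (contMDiffOn_chart_symm.contMDiffAt ((chartAt (Vec m) y).open_target.mem_nhds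
      ((chartAt (Vec m) y).map_source hy)) (n := ∞)).of_le ENat.LEInfty.out
  unfold chartFrame
  refine ContDiffAt.sum fun i _ => contDiffAt_const.smulRight ?_
  have h := ((tangentTriv y).contMDiffAt_section_iff (IB := 𝓡 m) (x₀ := y)
    (s := fun ξ => (ι ξ).symm (EuclideanSpace.single i 1)) hy).1 (hι (EuclideanSpace.single i 1))
  have h' : ContMDiffAt (𝓡 m) 𝓘(ℝ, Vec m) 1
      (fun ξ => (tangentTriv y ⟨ξ, (ι ξ).symm (EuclideanSpace.single i 1)⟩).2)
      ((chartAt (Vec m) y).symm (chartAt (Vec m) y y)) := by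
    rw [(chartAt (Vec m) y).left_inv hy]
    exact h
  exact (h'.comp _ hsymm).contDiffAt

/-- The differential of normal coordinates inverts the frame: `Dϑ_y(y) ∘ ι_y⁻¹ = id`, read in the
chart at `y`. This is the statement that `exp_y` has the identity as differential at `0`. -/
lemma fderiv_normalCoord_chartFrame [T2Space M]
    [CovariantDerivative.ContMDiffCovariantDerivative nabla ∞] {y : M}
    (hW : IsNormalDomain nabla y (W y)) {Θ : Vec m → Vec m}
    (hΘ : Θ = fun x => normalCoord nabla W ι y ((chartAt (Vec m) y).symm x))
    (hΘd : DifferentiableAt ℝ Θ (chartAt (Vec m) y y)) (κ : Vec m) :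
    fderiv ℝ Θ (chartAt (Vec m) y y) (chartFrame ι y (chartAt (Vec m) y y) κ) = κ := by
  have hy := mem_chart_source (Vec m) y
  set x₀ := chartAt (Vec m) y y with hx₀
  set Λ := chartFrame ι y x₀ with hΛ
  obtain ⟨C, hC, r, hr, hexp⟩ := expMap_expansion nabla y
  have hΛap : ∀ κ, (tangentTriv y ⟨y, (ι y).symm κ⟩).2 = Λ κ := fun κ =>
    (chartFrame_apply hy κ).symm
  set a : Vec m → Vec m := fun κ => chartAt (Vec m) y (expMap nabla y ((ι y).symm κ)) with ha
  have hsmall : ∀ᶠ κ in 𝓝 (0 : Vec m), ‖Λ κ‖ ≤ r := by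
    have h : Filter.Tendsto (fun κ => ‖Λ κ‖) (𝓝 0) (𝓝 0) := by
      have := (Λ.continuous.norm).tendsto 0
      simpa using this
    exact (h.eventually (gt_mem_nhds hr)).mono fun κ hκ => hκ.le
  have hbound : ∀ᶠ κ in 𝓝 (0 : Vec m), expMap nabla y ((ι y).symm κ) ∈
      (chartAt (Vec m) y).source ∧ ‖a κ - x₀ - Λ κ‖ ≤ C * ‖Λ κ‖ ^ 2 := by
    filter_upwards [hsmall] with κ hκ
    have h := hexp y hy (by simpa using hr.le) ((ι y).symm κ) (by rwa [hΛap])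
    rw [hΛap] at h
    exact h.2
  have ha0 : a 0 = x₀ := by simp only [ha, map_zero, expMap_zero, hx₀]
  have hO : (fun κ => a κ - x₀ - Λ κ) =O[𝓝 0] fun κ => ‖κ - 0‖ ^ 2 := by
    refine Asymptotics.IsBigO.of_bound (C * ‖Λ‖ ^ 2) ?_
    filter_upwards [hbound] with κ hκ
    rw [sub_zero, norm_pow, norm_norm, mul_assoc, ← mul_pow]
    refine hκ.2.trans ?_
    gcongr
    exact Λ.le_opNorm κ
  -- A quadratic remainder is differentiable with differential zero.
  have hda : HasFDerivAt a Λ 0 := by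
    have h := ((hO.hasFDerivAt one_lt_two).add (Λ.hasFDerivAt (x := 0))).add_const x₀
    rw [zero_add] at h
    refine h.congr_of_eventuallyEq (Filter.Eventually.of_forall fun κ => ?_)
    simp only [Pi.add_apply]
    abel
  have hdΘ : HasFDerivAt Θ (fderiv ℝ Θ x₀) (a 0) := by rw [ha0]; exact hΘd.hasFDerivAt
  have hid : (fun κ => Θ (a κ)) =ᶠ[𝓝 0] fun κ => κ := by
    have hopen : @IsOpen (Vec m) _ (W y) := hW.isOpen
    have h0 : (0 : Vec m) ∈ W y := hW.zero_mem
    let k : Vec m →L[ℝ] Vec m := ((ι y).symm : Vec m →L[ℝ] TangentSpace (𝓡 m) y)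
    have hkW : ∀ᶠ κ in 𝓝 (0 : Vec m), k κ ∈ W y :=
      k.continuous.continuousAt.preimage_mem_nhds (hopen.mem_nhds (by rwa [map_zero]))
    filter_upwards [hbound, hkW] with κ hκ hκW
    simp only [hΘ, ha]
    rw [(chartAt (Vec m) y).left_inv hκ.1, hW.normalCoord_expMap (v := (ι y).symm κ) hκW]
    exact (ι y).apply_symm_apply κ
  have huniq := ((hdΘ.comp 0 hda).congr_of_eventuallyEq hid.symm).unique (hasFDerivAt_id 0)
  exact congrArg (fun L : Vec m →L[ℝ] Vec m => L κ) huniq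

end NormalCoordinates

end ManifoldEKF

/-! ### Error propagation -/

open ManifoldEKF in
theorem lemma1
    {m : ℕ} {M : Type*} [TopologicalSpace M] [T2Space M] [ChartedSpace (Vec m) M]
    [IsManifold (𝓡 m) ∞ M]
    -- a smooth affine connection on the state space
    (nabla : CovariantDerivative (𝓡 m) (Vec m) (TangentSpace (𝓡 m) (M := M)))
    [CovariantDerivative.ContMDiffCovariantDerivative nabla ∞]
    -- the domains `W_ξ` and the isomorphisms `ı_ξ` that define the normal coordinates
    (W : ∀ ξ : M, Set (TangentSpace (𝓡 m) ξ)) (hW : ∀ ξ, IsNormalDomain nabla ξ (W ξ))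
    (ι : ∀ ξ : M, TangentSpace (𝓡 m) ξ ≃L[ℝ] Vec m)
    -- the system function, the input `u_{k+1}` and the estimate `ξ̂_{k|k}`
    {L : Type*} (F : M → L → M) (u : L) (ξhat : M)
    (hF : ContMDiffAt (𝓡 m) (𝓡 m) 2 (fun ξ => F ξ u) ξhat)
    -- the frames `ı_ξ⁻¹` are continuously differentiable in `ξ` around `ξ̂_{k+1|k}`
    (hι : ∀ w : Vec m, ContMDiffAt (𝓡 m) (𝓡 m).tangent 1
      (fun ξ => (⟨ξ, (ι ξ).symm w⟩ : TangentBundle (𝓡 m) M)) (F ξhat u)) :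
    ∃ C > (0 : ℝ), ∃ δ > (0 : ℝ),
      -- the true state `ξ_k` and the noise `κ_{k+1}`
      ∀ ξ ∈ expMap nabla ξhat '' W ξhat, ∀ κ : Vec m,
        ‖boxminus nabla W ι ξ ξhat‖ < δ → ‖κ‖ < δ →
        (ι (F ξ u)).symm κ ∈ expDomain nabla (F ξ u) ∧
        boxplus nabla ι (F ξ u) κ ∈ expMap nabla (F ξhat u) '' W (F ξhat u) ∧
        ‖boxminus nabla W ι (boxplus nabla ι (F ξ u) κ) (F ξhat u)
            - (stateMatrix nabla W ι (fun ξ => F ξ u) ξhat (boxminus nabla W ι ξ ξhat) + κ)‖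
          ≤ C * (‖boxminus nabla W ι ξ ξhat‖ ^ 2 + ‖κ‖ ^ 2) := by
  set f : M → M := fun ξ => F ξ u with hf
  set y : M := F ξhat u with hy
  have hys := mem_chart_source (Vec m) y
  have hyt := (chartAt (Vec m) y).map_source hys
  set h : Vec m → M := normalCoordInv nabla ι ξhat with hh
  have hh0 : h 0 = ξhat := normalCoordInv_zero ξhat
  have hhC : ContMDiffAt 𝓘(ℝ, Vec m) (𝓡 m) ∞ h 0 := (hW ξhat).contMDiffAt_normalCoordInv
  have hfh : ContMDiffAt 𝓘(ℝ, Vec m) (𝓡 m) 2 (fun e => f (h e)) 0 := by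
    have hF' : ContMDiffAt (𝓡 m) (𝓡 m) 2 f (h 0) := by rw [hh0]; exact hF
    exact hF'.comp 0 (hhC.of_le ENat.LEInfty.out)
  have hfh0 : f (h 0) = y := by rw [hh0]
  set Θ : Vec m → Vec m := fun x => normalCoord nabla W ι y ((chartAt (Vec m) y).symm x) with hΘ
  set g : Vec m → Vec m := fun e => chartAt (Vec m) y (f (h e)) with hg
  have hg0 : g 0 = chartAt (Vec m) y y := by simp only [hg, hfh0]
  have hΘC : ContDiffAt ℝ 2 Θ (g 0) := by
    have h1 : ContMDiffAt (𝓡 m) 𝓘(ℝ, Vec m) 2 (normalCoord nabla W ι y)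
        ((chartAt (Vec m) y).symm (chartAt (Vec m) y y)) := by
      rw [(chartAt (Vec m) y).left_inv hys]
      exact (hW y).contMDiffAt_normalCoord.of_le ENat.LEInfty.out
    have h2 : ContMDiffAt (𝓡 m) (𝓡 m) 2 (chartAt (Vec m) y).symm (chartAt (Vec m) y y) :=
      (contMDiffOn_chart_symm.contMDiffAt ((chartAt (Vec m) y).open_target.mem_nhds hyt)
        (n := ∞)).of_le ENat.LEInfty.out
    rw [hg0]
    exact (h1.comp _ h2).contDiffAt
  have hgC : ContDiffAt ℝ 2 g 0 := by
    have h1 : ContMDiffAt (𝓡 m) (𝓡 m) 2 (chartAt (Vec m) y) (f (h 0)) := by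
      rw [hfh0]
      exact (contMDiffOn_chart.contMDiffAt ((chartAt (Vec m) y).open_source.mem_nhds hys)
        (n := ∞)).of_le ENat.LEInfty.out
    exact (h1.comp (0 : Vec m) hfh).contDiffAt
  obtain ⟨C₁, hC₁, r₁, hr₁, hexp⟩ := expMap_expansion nabla y
  have hU : expMap nabla y '' W y ∈ 𝓝 y := (hW y).isOpen_image.mem_nhds (hW y).mem_image_self
  -- Chart values near `g 0` belong to points of the image of `W y`, where `Θ` is meaningful.
  have hN : (chartAt (Vec m) y).symm ⁻¹' (expMap nabla y '' W y) ∈ 𝓝 (g 0) := by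
    rw [hg0]
    refine ((chartAt (Vec m) y).continuousAt_symm hyt).preimage_mem_nhds ?_
    rwa [(chartAt (Vec m) y).left_inv hys]
  obtain ⟨C, hC, δ, hδ, hmain⟩ := exists_second_order_bound (Λ := chartFrame ι y) hΘC hgC
    (by rw [hg0]; exact contDiffAt_chartFrame hι)
    (by
      rw [hg0] at hΘC ⊢
      exact fderiv_normalCoord_chartFrame (hW y) hΘ (hΘC.differentiableAt (by simp)))
    hN hC₁ hr₁
  -- The estimates in the chart apply only as long as `f (h e)` lies in its domain.
  obtain ⟨δ', hδ', hsource⟩ := Metric.nhds_basis_ball.mem_iff.1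
    (hfh.continuousAt.preimage_mem_nhds
      ((chartAt (Vec m) y).open_source.mem_nhds (by rw [hfh0]; exact hys)))
  have hΘg : (fun e => Θ (g e)) =ᶠ[𝓝 0] fun e => normalCoord nabla W ι y (f (h e)) := by
    filter_upwards [Metric.ball_mem_nhds (0 : Vec m) hδ'] with e he
    simp only [hΘ, hg, (chartAt (Vec m) y).left_inv (hsource he)]
  have hA : fderiv ℝ (fun e => Θ (g e)) 0 = stateMatrix nabla W ι f ξhat := by
    rw [hΘg.fderiv_eq]
    exact (hasFDerivAt_comp_comp hh0 (hhC.mdifferentiableAt (by simp))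
      (hF.mdifferentiableAt (by simp))
      ((hW y).contMDiffAt_normalCoord.mdifferentiableAt (by simp)) fun e => rfl).fderiv
  have hΘ0 : Θ (g 0) = 0 := by
    have h1 := (hW y).normalCoord_expMap (ι := ι) (hW y).zero_mem
    rw [expMap_zero, map_zero] at h1
    simp only [hΘ, hg0, (chartAt (Vec m) y).left_inv hys, h1]
  refine ⟨C, hC, min δ δ', lt_min hδ hδ', fun ξ hξ κ hε hκ => ?_⟩
  set ε : Vec m := boxminus nabla W ι ξ ξhat with hεdef
  have hhε : h ε = ξ := normalCoordInv_normalCoord hξ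
  have hξs : f ξ ∈ (chartAt (Vec m) y).source := by
    have := hsource (show ε ∈ Metric.ball (0 : Vec m) δ' by
      simpa using hε.trans_le (min_le_right _ _))
    rwa [mem_preimage, hhε] at this
  have hgε : g ε = chartAt (Vec m) y (f ξ) := by simp only [hg, hhε]
  obtain ⟨hx, hv, ha⟩ := hmain ε κ (hε.trans_le (min_le_left _ _)) (hκ.trans_le (min_le_left _ _))
  rw [hgε] at hx hv ha
  rw [hg0] at hx
  rw [chartFrame_apply hξs] at hv ha
  obtain ⟨hdom, hmem, hest⟩ := hexp (f ξ) hξs hx ((ι (f ξ)).symm κ) hv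
  obtain ⟨haN, hfinal⟩ := ha _ hest
  rw [mem_preimage, (chartAt (Vec m) y).left_inv hmem] at haN
  refine ⟨hdom, haN, ?_⟩
  rw [hΘ0, sub_zero, hA] at hfinal
  simp only [hΘ, (chartAt (Vec m) y).left_inv hmem] at hfinal
  exact hfinal

end
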